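/- Let $S_n$ be the group of permutations $w=a_1a_2\cdots a_n$ of $\{1,\dots,n\}$ ($n\ge 0$). Call $w$ \emph{alternating} if $a_1>a_2<a_3>a_4<\cdots$ and \emph{reverse alternating} if $a_1<a_2>a_3<a_4>\cdots$. Let $E_n$ be the number of alternating $w\in S_n$ (the Euler number), let $f(n)$ be the number of $w\in S_n$ such that both $w$ and $w^{-1}$ are alternating, and let $f^*(n)$ be the number of $w\in S_n$ such that $w$ is alternating and $w^{-1}$ is reverse alternating; put $f(-2)=0$. Let $$L(t)=\frac12\log\frac{1+t}{1-t}.$$ Then $L(t)=t+\frac{t^3}{3}+\frac{t^5}{5}+\cdots$, and, as identities of formal power series over $\mathbb{Q}$ (the infinite sums over $r$ converging coefficientwise) and for all integers $k\ge 0$, \begin{align*} \sum_{k\ge0} f(2k+1)\,t^{2k+1} &= \sum_{r\ge 0} E_{2r+1}^2\,\frac{L(t)^{2r+1}}{(2r+1)!},\\ f^*(2k+1) &= f(2k+1),\\ \sum_{k\ge0} f(2k)\,t^{2k} &= \frac{1}{\sqrt{1-t^2}}\sum_{r\ge 0} E_{2r}^2\,\frac{L(t)^{2r}}{(2r)!},\\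 f^*(2k) &= f(2k)-f(2k-2). \end{align*} -/

import Mathlib

namespace DoublyAlternating

/-- `a₁ > a₂ < a₃ > a₄ < ⋯` for the word `a₁ a₂ ⋯ aₙ` of `w` (positions are indexed from `0`
here, so the descents are exactly at the even indices). -/
def IsAlternating {n : ℕ} (w : Equiv.Perm (Fin n)) : Prop :=
  ∀ (i : ℕ) (h : i + 1 < n),
    (Even i → w ⟨i + 1, h⟩ < w ⟨i, Nat.lt_of_succ_lt h⟩) ∧
    (Odd i → w ⟨i, Nat.lt_of_succ_lt h⟩ < w ⟨i + 1, h⟩)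

/-- `a₁ < a₂ > a₃ < a₄ > ⋯` for the word `a₁ a₂ ⋯ aₙ` of `w`. -/
def IsReverseAlternating {n : ℕ} (w : Equiv.Perm (Fin n)) : Prop :=
  ∀ (i : ℕ) (h : i + 1 < n),
    (Even i → w ⟨i, Nat.lt_of_succ_lt h⟩ < w ⟨i + 1, h⟩) ∧
    (Odd i → w ⟨i + 1, h⟩ < w ⟨i, Nat.lt_of_succ_lt h⟩)

/-- The Euler number `Eₙ`: the number of alternating permutations in `Sₙ`. -/
noncomputable def eulerNumber (n : ℕ) : ℕ :=
  Nat.card {w : Equiv.Perm (Fin n) // IsAlternating w}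

/-- `f(n)`: the number of `w ∈ Sₙ` with `w` and `w⁻¹` both alternating. -/
noncomputable def f (n : ℕ) : ℕ :=
  Nat.card {w : Equiv.Perm (Fin n) // IsAlternating w ∧ IsAlternating w⁻¹}

/-- `f*(n)`: the number of `w ∈ Sₙ` with `w` alternating and `w⁻¹` reverse alternating. -/
noncomputable def fStar (n : ℕ) : ℕ :=
  Nat.card {w : Equiv.Perm (Fin n) // IsAlternating w ∧ IsReverseAlternating w⁻¹}

/-- The formal power series `L(t) = ½ log ((1 + t) / (1 - t))`. -/
noncomputable def L : PowerSeries ℚ :=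
  (1 / 2 : ℚ) • PowerSeries.logOf ((1 + PowerSeries.X) * (1 - PowerSeries.X)⁻¹)

/-- The formal power series `(1 - t²)^(-1/2)`: the binomial series `(1 + u)^(-1/2)` at
`u = -t²`. -/
noncomputable def invSqrtOneSubSq : PowerSeries ℚ :=
  (PowerSeries.binomialSeries ℚ (-1 / 2 : ℚ)).subst (-PowerSeries.X ^ 2 : PowerSeries ℚ)

/-- `∑ r, F r = S` as formal power series, that is, with respect to the topology of coefficientwise
convergence, where the coefficient field `ℚ` is discrete. -/
def HasFormalSum (F : ℕ → PowerSeries ℚ) (S : PowerSeries ℚ) : Prop :=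
  letI : TopologicalSpace ℚ := ⊥
  letI : TopologicalSpace (PowerSeries ℚ) := PowerSeries.WithPiTopology.instTopologicalSpace ℚ
  HasSum F S

/-- The formal power series `∑ₖ f(2k+1) t^(2k+1)`. -/
noncomputable def fOddSeries : PowerSeries ℚ :=
  PowerSeries.mk fun n => if Odd n then (f n : ℚ) else 0

/-- The formal power series `∑ₖ f(2k) t^(2k)`. -/
noncomputable def fEvenSeries : PowerSeries ℚ :=
  PowerSeries.mk fun n => if Even n then (f n : ℚ) else 0

end DoublyAlternating

/-! ### Inclusion-exclusion over the falls of a zigzag -/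

namespace DoublyAlternating

open Finset
open scoped Classical

/-! Complementing values and reversing positions turns f, and f* in odd length, into the number of σ
such that σ and σ⁻¹ both zigzag starting with a rise (`f_eq_reverseCount`,
`fStar_eq_reverseCount_of_odd`). The rest is a symmetric-function argument: up to signs, zigzag
ribbons are generated by 1/Σ h_{2j} in even degree and by Σ h_{2j+1}/Σ h_{2j} in odd degree.

Inclusion-exclusion (`sum_ind_rises_zigzag`) on words of fixed content gives this as a recursion
(`sum_signedZigzagWords`). As 1/(1-x) = (1-x²)^(-1/2) exp L(x), the two quotients are ∏ √(1-x_v²) ·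
sech(Σ L(x_v)) and tanh(Σ L(x_v)). Let Φ be the linear functional sending y^r to r! times the
coefficient of z^r in sech z, respectively tanh z. Both quotients then become Φ of a product ∏
G(x_v) over the letters, where G(t) = U(t) exp(y L(t)) with U = √(1-t²), respectively U = 1. So
zigzag words of given content are counted, up to sign, by Φ of a product of coefficients of G
(`signedZigzagWords_eq_of_even`, `signedZigzagWords_eq_of_odd`).

By standardization (`card_risesOnTies`) the same words count the σ with zigzag inverse and
prescribed rises. A second inclusion-exclusion, along σ itself (`mixedCount_eq`), gives f(n) =
Φ(qₙ), where Σ qₙ tⁿ is the quotient of 1 plus the odd part of G by the even part of G, that is U⁻¹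
sech(yL) + tanh(yL). In sech(yL) or tanh(yL) the power y^r has coefficient ±E_r L^r/r!, and Φ
multiplies it by the same ±E_r; this is how the squares arise (`momentFunctional_coeff`). For f*(2k)
the word of σ starts with a fall, and cosh - sinh · tanh = sech leads to U sech(yL) instead. This is
1 - t² times the series U⁻¹ sech(yL), whence f(2k) - f(2k-2). -/

/-- A sequence of rises and falls (`up i` says that step `i` is a rise) rises on the first `k`
letters from position `p` on. -/
def Rises (up : ℕ → Prop) (p k : ℕ) : Prop := ∀ i, i + 1 < k → up (p + i)

/-- The `m` letters from position `p` on form a zigzag that starts with a rise. -/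
def Zigzag (up : ℕ → Prop) (p m : ℕ) : Prop := ∀ i, i + 1 < m → (up (p + i) ↔ Even i)

/-- `1` if `P` holds and `0` otherwise. -/
noncomputable def ind (P : Prop) : ℤ := if P then 1 else 0

lemma ind_congr {P Q : Prop} (h : P ↔ Q) : ind P = ind Q := by simp [ind, h]

lemma ind_split (P Q : Prop) : ind P = ind (P ∧ ¬ Q) + ind (P ∧ Q) := by
  by_cases P <;> by_cases Q <;> simp_all [ind]

lemma zigzag_zero (up : ℕ → Prop) (p : ℕ) : Zigzag up p 0 := fun i h => by omega

lemma zigzag_one (up : ℕ → Prop) (p : ℕ) : Zigzag up p 1 := fun i h => by omega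

lemma rises_zero (up : ℕ → Prop) (p : ℕ) : Rises up p 0 := fun i h => by omega

lemma rises_one (up : ℕ → Prop) (p : ℕ) : Rises up p 1 := fun i h => by omega

lemma rises_succ_succ (up : ℕ → Prop) (p k : ℕ) :
    Rises up p (k + 2) ↔ Rises up p (k + 1) ∧ up (p + k) := by
  refine ⟨fun h => ⟨fun i hi => h i (by omega), h k (by omega)⟩, fun h i hi => ?_⟩
  rcases Nat.lt_or_ge (i + 1) (k + 1) with h1 | h1
  · exact h.1 i h1
  · obtain rfl : i = k := by omega
    exact h.2

lemma rises_succ_succ' (up : ℕ → Prop) (p k : ℕ) :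
    Rises up p (k + 2) ↔ up p ∧ Rises up (p + 1) (k + 1) := by
  refine ⟨fun h => ⟨h 0 (by omega), fun i hi => ?_⟩, fun h i hi => ?_⟩
  · have := h (i + 1) (by omega)
    rwa [show p + 1 + i = p + (i + 1) by ring]
  · rcases i with _ | i
    · exact h.1
    · have := h.2 i (by omega)
      rwa [show p + 1 + i = p + (i + 1) by ring] at this

lemma zigzag_add_two (up : ℕ → Prop) (p m : ℕ) :
    Zigzag up p (m + 2) ↔ up p ∧ (0 < m → ¬ up (p + 1)) ∧ Zigzag up (p + 2) m := by
  refine ⟨fun h => ⟨by simpa using h 0 (by omega), fun hm => by simpa using h 1 (by omega),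
    fun i hi => ?_⟩, fun h i hi => ?_⟩
  · have := h (i + 2) (by omega)
    rw [show p + 2 + i = p + (i + 2) by ring, this]
    simp [Nat.even_add]
  · rcases i with _ | _ | i
    · simpa using h.1
    · simpa using h.2.1 (by omega)
    · have := h.2.2 i (by omega)
      rw [show p + 2 + i = p + (i + 2) by ring] at this
      rw [this]
      simp [Nat.even_add]

/-- Inclusion-exclusion over the falls of a zigzag. -/
theorem sum_ind_rises_zigzag (up : ℕ → Prop) (p m : ℕ) :
    ∑ j ∈ range (m / 2 + 1),
        (-1 : ℤ) ^ j * ind (Rises up p (2 * j) ∧ Zigzag up (p + 2 * j) (m - 2 * j)) =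
      if Even m then (if m = 0 then 1 else 0) else (-1) ^ (m / 2) * ind (Rises up p m) := by
  -- `E j` adds to `D j` a fall at the joint of the two blocks, or nothing if the second block is
  -- empty. A rise at the joint lengthens the rising block by two letters, after which the zigzag
  -- must fall. Hence `D N` splits into `E N` and `E (N + 1)`, and the alternating sum telescopes.
  set D : ℕ → Prop := fun j => Rises up p (2 * j) ∧ Zigzag up (p + 2 * j) (m - 2 * j) with hD
  set E : ℕ → Prop := fun j => D j ∧ (2 * j < m → ¬ up (p + 2 * j - 1)) with hE
  have step : ∀ N, 1 ≤ N → 2 * N + 2 ≤ m → ind (D N) = ind (E N) + ind (E (N + 1)) := by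
    intro N hN hm
    rw [ind_split (D N) (up (p + 2 * N - 1))]
    congr 1
    · exact ind_congr (by simp only [hE]; rw [imp_iff_right (by omega : 2 * N < m)])
    · apply ind_congr
      obtain ⟨k, rfl⟩ : ∃ k, m = 2 * N + 2 + k := ⟨m - (2 * N + 2), by omega⟩
      obtain ⟨N, rfl⟩ : ∃ M, N = M + 1 := ⟨N - 1, by omega⟩
      simp only [hE, hD]
      rw [show 2 * (N + 1) + 2 + k - 2 * (N + 1) = k + 2 by omega,
        show 2 * (N + 1) + 2 + k - 2 * (N + 1 + 1) = k by omega, zigzag_add_two,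
        show 2 * (N + 1 + 1) = (2 * (N + 1)) + 2 by ring, rises_succ_succ,
        show 2 * (N + 1) + 1 = 2 * N + 1 + 2 by ring, rises_succ_succ,
        show p + 2 * (N + 1) - 1 = p + (2 * N + 1) by omega,
        show p + (2 * (N + 1) + 2) - 1 = p + 2 * (N + 1) + 1 by omega,
        show 2 * N + 1 + 1 = 2 * (N + 1) by ring,
        show p + (2 * (N + 1) + 2) = p + 2 * (N + 1) + 2 by omega]
      have : (2 * (N + 1) + 2 < 2 * (N + 1) + 2 + k) ↔ 0 < k := by omega
      rw [this]
      tauto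
  have partial_sum : ∀ N, 1 ≤ N → 2 * N ≤ m →
      ∑ j ∈ range N, (-1 : ℤ) ^ j * ind (D j) = (-1) ^ (N - 1) * ind (E N) := by
    intro N hN
    induction N, hN using Nat.le_induction with
    | base =>
      intro hm
      simp only [range_one, sum_singleton, pow_zero, one_mul, Nat.sub_self]
      apply ind_congr
      obtain ⟨k, rfl⟩ : ∃ k, m = k + 2 := ⟨m - 2, by omega⟩
      simp only [hE, hD]
      rw [show k + 2 - 2 * 0 = k + 2 by omega, show k + 2 - 2 * 1 = k by omega, mul_zero,
        mul_one, add_zero, zigzag_add_two, show p + 2 - 1 = p + 1 by omega,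
        rises_succ_succ up p 0]
      have h0 := rises_zero up p
      have h1 := rises_one up p
      have : 2 < k + 2 ↔ 0 < k := by omega
      rw [this]
      simp only [zero_add, add_zero]
      tauto
    | succ N hN ih =>
      intro hm
      rw [sum_range_succ, ih (by omega), step N hN (by omega)]
      obtain ⟨N, rfl⟩ : ∃ M, N = M + 1 := ⟨N - 1, by omega⟩
      simp only [Nat.add_sub_cancel]
      ring
  rcases Nat.lt_or_ge m 2 with hm | hm
  · interval_cases m
    · simp [ind, rises_zero, zigzag_zero]
    · simp [ind, rises_zero, rises_one, zigzag_one]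
  · rw [sum_range_succ, partial_sum (m / 2) (by omega) (by omega)]
    obtain ⟨N, hN⟩ : ∃ M, m / 2 = M + 1 := ⟨m / 2 - 1, by omega⟩
    -- For even `m` the last summand has an empty zigzag and cancels the partial sum. For odd `m`
    -- one letter remains, and a rise into it gives the fully rising word.
    rcases Nat.even_or_odd' m with ⟨k, hk | hk⟩
    · rw [if_pos (by simp [hk]), if_neg (by omega)]
      have : E (m / 2) ↔ D (m / 2) := by
        simp only [hE]
        have : ¬ (2 * (m / 2) < m) := by omega
        tauto
      rw [ind_congr this, hN, Nat.add_sub_cancel]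
      ring
    · rw [if_neg (by simp [hk])]
      have h1 : ind (D (m / 2)) = ind (E (m / 2)) + ind (Rises up p m) := by
        rw [ind_split (D (m / 2)) (up (p + 2 * (m / 2) - 1))]
        congr 1
        · exact ind_congr (by
            simp only [hE]; rw [imp_iff_right (by omega : 2 * (m / 2) < m)])
        · apply ind_congr
          simp only [hD]
          rw [show m - 2 * (m / 2) = 1 by omega]
          have e := rises_succ_succ up p (2 * N + 1)
          rw [show 2 * N + 1 + 2 = m by omega, show 2 * N + 1 + 1 = 2 * (m / 2) by omega,
            show p + (2 * N + 1) = p + 2 * (m / 2) - 1 by omega] at e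
          have := zigzag_one up (p + 2 * (m / 2))
          tauto
      rw [h1, hN, Nat.add_sub_cancel]
      ring

/-- Inclusion-exclusion over the falls of a zigzag of even length that starts with a fall. -/
theorem sum_ind_rises_zigzag_fall (up : ℕ → Prop) (p k : ℕ) :
    ∑ j ∈ range (k + 1), (-1 : ℤ) ^ j *
        ind (Rises up p (2 * j + 1) ∧ Zigzag up (p + 2 * j + 1) (2 * k + 1 - 2 * j)) =
      ind (¬ up p ∧ Zigzag up (p + 1) (2 * k + 1)) + (-1) ^ k * ind (Rises up p (2 * k + 2)) := by
  have h := sum_ind_rises_zigzag up (p + 1) (2 * k + 1)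
  rw [if_neg (by simp), show (2 * k + 1) / 2 = k by omega, sum_range_succ'] at h
  rw [sum_range_succ']
  -- All terms but the first carry the factor `ind (up p)` and otherwise agree with those of the
  -- odd-length identity at `p + 1`. The first leaves step `p` free, and the difference is the word
  -- with a fall there.
  have e : ∀ j, ind (Rises up p (2 * (j + 1) + 1) ∧
      Zigzag up (p + 2 * (j + 1) + 1) (2 * k + 1 - 2 * (j + 1))) =
      ind (up p) * ind (Rises up (p + 1) (2 * (j + 1)) ∧
        Zigzag up (p + 1 + 2 * (j + 1)) (2 * k + 1 - 2 * (j + 1))) := by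
    intro j
    rw [show 2 * (j + 1) + 1 = 2 * j + 1 + 2 by ring, rises_succ_succ',
      show p + 2 * (j + 1) + 1 = p + 1 + 2 * (j + 1) by ring,
      show 2 * j + 1 + 1 = 2 * (j + 1) by ring]
    simp only [ind]
    split_ifs <;> simp_all
  have e' : ind (Rises up p (2 * k + 2)) = ind (up p) * ind (Rises up (p + 1) (2 * k + 1)) := by
    rw [rises_succ_succ']
    simp only [ind]
    split_ifs <;> simp_all
  have e'' : ind (¬ up p ∧ Zigzag up (p + 1) (2 * k + 1)) =
      (1 - ind (up p)) * ind (Zigzag up (p + 1) (2 * k + 1)) := by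
    simp only [ind]
    split_ifs <;> simp_all
  have z : ∀ q, ind (Rises up p 1 ∧ q) = ind q := fun q => ind_congr (by simp [rises_one])
  have z' : ∀ q, ind (Rises up (p + 1) 0 ∧ q) = ind q := fun q => ind_congr (by simp [rises_zero])
  simp only [mul_zero, zero_add, add_zero, Nat.sub_zero, pow_zero, one_mul, z, z'] at h ⊢
  rw [e', e'']
  simp only [e]
  have : ∀ j, (-1 : ℤ) ^ (j + 1) * (ind (up p) * ind (Rises up (p + 1) (2 * (j + 1)) ∧
        Zigzag up (p + 1 + 2 * (j + 1)) (2 * k + 1 - 2 * (j + 1)))) =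
      ind (up p) * ((-1 : ℤ) ^ (j + 1) * ind (Rises up (p + 1) (2 * (j + 1)) ∧
        Zigzag up (p + 1 + 2 * (j + 1)) (2 * k + 1 - 2 * (j + 1)))) := fun j => by ring
  simp only [this, ← mul_sum]
  rw [eq_sub_of_add_eq h]
  ring

lemma sum_ind_eq_card {α : Type*} (B : Finset α) (P : α → Prop) [DecidablePred P] :
    ∑ x ∈ B, ind (P x) = #{x ∈ B | P x} := by
  rw [card_filter, Nat.cast_sum]
  exact sum_congr rfl fun x _ => by by_cases h : P x <;> simp [ind, h]

end DoublyAlternating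

/-! ### Zigzag words with given content -/

namespace DoublyAlternating

open Finset
open scoped Classical

/-- Step `i` of the word `l` is a weak rise. -/
def wordUp (l : List ℕ) (i : ℕ) : Prop := l.getD i 0 ≤ l.getD (i + 1) 0

/-- The words with content `s`. -/
noncomputable def words (s : Multiset ℕ) : Finset (List ℕ) := s.lists.toFinset

lemma mem_words {s : Multiset ℕ} {l : List ℕ} : l ∈ words s ↔ (l : Multiset ℕ) = s := by
  simp [words, Multiset.mem_lists_iff, eq_comm]

lemma length_of_mem_words {s : Multiset ℕ} {l : List ℕ} (h : l ∈ words s) :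
    l.length = Multiset.card s := by
  rw [← mem_words.1 h, Multiset.coe_card]

/-- The number of words `u₁ ≤ u₂ > u₃ ≤ ⋯` with content `s`. -/
noncomputable def zigzagWords (s : Multiset ℕ) : ℕ :=
  #{l ∈ words s | Zigzag (wordUp l) 0 (Multiset.card s)}

lemma rises_iff_pairwise (l : List ℕ) :
    Rises (wordUp l) 0 l.length ↔ l.Pairwise (· ≤ ·) := by
  rw [← List.isChain_iff_pairwise, List.isChain_iff_getElem]
  refine forall_congr' fun i => forall_congr' fun hi => ?_
  simp only [wordUp, zero_add]
  rw [List.getD_eq_getElem _ _ (by omega), List.getD_eq_getElem _ _ hi]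

lemma rises_append (l l' : List ℕ) :
    Rises (wordUp (l ++ l')) 0 l.length ↔ Rises (wordUp l) 0 l.length := by
  refine forall_congr' fun i => forall_congr' fun hi => ?_
  simp only [wordUp, zero_add]
  rw [List.getD_append _ _ _ _ (by omega), List.getD_append _ _ _ _ hi]

lemma zigzag_append (l l' : List ℕ) (m : ℕ) :
    Zigzag (wordUp (l ++ l')) l.length m ↔ Zigzag (wordUp l') 0 m := by
  refine forall_congr' fun i => forall_congr' fun hi => ?_
  simp only [wordUp, zero_add]
  rw [List.getD_append_right _ _ _ _ (by omega), List.getD_append_right _ _ _ _ (by omega)]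
  rw [show l.length + i - l.length = i by omega, show l.length + i + 1 - l.length = i + 1 by omega]

lemma pairwise_eq_sort {l : List ℕ} (h : l.Pairwise (· ≤ ·)) :
    l = (l : Multiset ℕ).sort (· ≤ ·) :=
  List.Perm.eq_of_pairwise' h (Multiset.pairwise_sort _ _)
    (Multiset.coe_eq_coe.1 (Multiset.sort_eq _ _).symm)

/-- Splitting a word after its weakly increasing prefix of length `i`. -/
theorem card_words_rises_zigzag (s : Multiset ℕ) (i : ℕ) (hi : i ≤ Multiset.card s) :
    #{l ∈ words s | Rises (wordUp l) 0 i ∧ Zigzag (wordUp l) (0 + i) (Multiset.card s - i)} =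
      ∑ c ∈ Iic s with Multiset.card c = i, zigzagWords (s - c) := by
  -- A weakly increasing prefix is determined by its content `c`, being the sorted list of `c`; what
  -- follows is any zigzag word of content `s - c`.
  rw [card_eq_sum_card_fiberwise (f := fun l : List ℕ => (l.take i : Multiset ℕ))
    (t := {c ∈ Iic s | Multiset.card c = i})]
  · refine sum_congr rfl fun c hc => ?_
    obtain ⟨hcs, hci⟩ : c ≤ s ∧ Multiset.card c = i := by simpa using hc
    have hlen : (c.sort (· ≤ ·)).length = i := by simp [hci]
    have key : ∀ l' : List ℕ, (Rises (wordUp (c.sort (· ≤ ·) ++ l')) 0 i ∧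
        Zigzag (wordUp (c.sort (· ≤ ·) ++ l')) (0 + i) (Multiset.card s - i)) ↔
        Zigzag (wordUp l') 0 (Multiset.card (s - c)) := by
      intro l'
      have h1 := (rises_append (c.sort (· ≤ ·)) l').2
        ((rises_iff_pairwise _).2 (Multiset.pairwise_sort _ _))
      have h2 := zigzag_append (c.sort (· ≤ ·)) l' (Multiset.card s - i)
      rw [hlen] at h1 h2
      rw [zero_add, h2, Multiset.card_sub hcs, hci]
      exact and_iff_right h1
    have split : ∀ l ∈ words s, Rises (wordUp l) 0 i → (l.take i : Multiset ℕ) = c →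
        l = c.sort (· ≤ ·) ++ l.drop i := by
      intro l hl hr hlc
      have hlen' : (l.take i).length = i := by
        rw [List.length_take, length_of_mem_words hl, min_eq_left hi]
      have : l.take i = c.sort (· ≤ ·) := by
        rw [← hlc]
        apply pairwise_eq_sort
        rw [← rises_iff_pairwise, ← rises_append _ (l.drop i), List.take_append_drop, hlen']
        exact hr
      rw [← this, List.take_append_drop]
    refine card_bij' (fun l _ => l.drop i) (fun l' _ => c.sort (· ≤ ·) ++ l') ?_ ?_ ?_ ?_
    · intro l hl
      simp only [mem_filter] at hl
      obtain ⟨⟨hls, hl⟩, hlc⟩ := hl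
      have e := split l hls hl.1 hlc
      rw [mem_filter, mem_words]
      refine ⟨?_, ?_⟩
      · rw [← mem_words.1 hls, ← hlc]
        refine (tsub_eq_of_eq_add ?_).symm
        rw [Multiset.coe_add]
        exact Multiset.coe_eq_coe.2 ((List.perm_append_comm).trans
          (by rw [List.take_append_drop])).symm
      · rw [← key, ← e]
        exact hl
    · intro l' hl'
      rw [mem_filter, mem_words] at hl'
      simp only [mem_filter]
      refine ⟨⟨?_, (key l').2 hl'.2⟩, ?_⟩
      · rw [mem_words, ← Multiset.coe_add, hl'.1, Multiset.sort_eq, add_tsub_cancel_of_le hcs]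
      · rw [List.take_left' hlen, Multiset.sort_eq]
    · intro l hl
      simp only [mem_filter] at hl
      exact (split l hl.1.1 hl.1.2.1 hl.2).symm
    · intro l' hl'
      exact List.drop_left' hlen
  · intro l hl
    simp only [coe_filter, Set.mem_ofPred_eq, mem_Iic] at hl ⊢
    refine ⟨?_, ?_⟩
    · rw [← mem_words.1 hl.1, Multiset.coe_le]
      exact (List.take_sublist _ _).subperm
    · rw [Multiset.coe_card, List.length_take, length_of_mem_words hl.1, min_eq_left hi]

/-- The number of zigzag words with content `s`, up to a sign that depends on the length only. -/
noncomputable def signedZigzagWords (s : Multiset ℕ) : ℤ :=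
  (-1) ^ (Multiset.card s / 2) * zigzagWords s

lemma card_words_rises (s : Multiset ℕ) :
    #{l ∈ words s | Rises (wordUp l) 0 (Multiset.card s)} = 1 := by
  rw [card_eq_one]
  refine ⟨s.sort (· ≤ ·), ?_⟩
  ext l
  rw [mem_filter, mem_singleton]
  constructor
  · rintro ⟨hl, hr⟩
    rw [← length_of_mem_words hl, rises_iff_pairwise] at hr
    rw [pairwise_eq_sort hr, mem_words.1 hl]
  · rintro rfl
    refine ⟨mem_words.2 (Multiset.sort_eq _ _), ?_⟩
    have := (rises_iff_pairwise _).2 (Multiset.pairwise_sort s (· ≤ ·))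
    rwa [Multiset.length_sort] at this

/-- The recursion for zigzag words given by inclusion-exclusion. -/
theorem sum_signedZigzagWords (s : Multiset ℕ) :
    ∑ c ∈ Iic s with Even (Multiset.card c), signedZigzagWords (s - c) =
      if Even (Multiset.card s) then (if s = 0 then 1 else 0) else 1 := by
  have h := sum_congr (rfl : words s = words s)
    fun l _ => sum_ind_rises_zigzag (wordUp l) 0 (Multiset.card s)
  rw [sum_comm] at h
  -- Removing `2 * j` letters lowers the half-length by `j`, so `(-1) ^ j` is absorbed into the sign
  -- of `signedZigzagWords`, up to one global sign.
  have e : ∀ j ∈ range (Multiset.card s / 2 + 1), ∑ l ∈ words s, (-1 : ℤ) ^ j *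
      ind (Rises (wordUp l) 0 (2 * j) ∧
        Zigzag (wordUp l) (0 + 2 * j) (Multiset.card s - 2 * j)) =
      (-1) ^ (Multiset.card s / 2) * ∑ c ∈ {c ∈ Iic s | Even (Multiset.card c)} with
        Multiset.card c / 2 = j, signedZigzagWords (s - c) := by
    intro j hj
    rw [mem_range] at hj
    rw [← mul_sum, sum_ind_eq_card, card_words_rises_zigzag s (2 * j) (by omega), Nat.cast_sum,
      mul_sum, mul_sum, filter_filter]
    have : {c ∈ Iic s | Even (Multiset.card c) ∧ Multiset.card c / 2 = j} =
        {c ∈ Iic s | Multiset.card c = 2 * j} := by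
      ext c
      simp only [mem_filter, and_congr_right_iff]
      intro _
      rw [Nat.even_iff]
      omega
    rw [this]
    refine sum_congr rfl fun c hc => ?_
    simp only [mem_filter, mem_Iic] at hc
    rw [signedZigzagWords, Multiset.card_sub hc.1, hc.2, ← mul_assoc]
    congr 1
    rw [← pow_add]
    apply neg_one_pow_congr
    rw [show (Multiset.card s - 2 * j) / 2 = Multiset.card s / 2 - j by omega]
    simp only [Nat.even_iff]
    omega
  rw [sum_congr rfl e, ← mul_sum, sum_fiberwise_of_maps_to] at h
  · by_cases hev : Even (Multiset.card s)
    · simp only [if_pos hev] at h ⊢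
      by_cases h0 : s = 0
      · subst h0
        have : words 0 = {[]} := by ext l; simp [mem_words]
        simpa [this] using h
      · have h1 : Multiset.card s ≠ 0 := fun h => h0 (Multiset.card_eq_zero.1 h)
        rw [if_neg h0]
        simpa [h1, hev] using h
    · simp only [if_neg hev] at h ⊢
      rw [← mul_sum, sum_ind_eq_card, card_words_rises] at h
      simpa using h
  · intro c hc
    simp only [mem_filter, mem_Iic] at hc
    have := Multiset.card_le_card hc.1
    simp only [mem_range]
    omega

/-- Expanding a product of sums over the sub-multisets of `s`. -/
theorem sum_Iic_prod_count {R : Type*} [CommSemiring R] (s : Multiset ℕ) (F : ℕ → ℕ → R) :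
    ∑ c ∈ Iic s, ∏ v ∈ s.toFinset, F v (c.count v) =
      ∏ v ∈ s.toFinset, ∑ j ∈ range (s.count v + 1), F v j := by
  rw [prod_sum]
  -- A sub-multiset is an independent choice of multiplicities; these two facts show that the
  -- multiset built from such a choice has the chosen counts.
  have cnt : ∀ (p : ∀ a ∈ s.toFinset, ℕ) (v : ℕ) (hv : v ∈ s.toFinset),
      Multiset.count v (∑ x ∈ s.toFinset.attach, Multiset.replicate (p x.1 x.2) x.1) = p v hv := by
    intro p v hv
    rw [Multiset.count_sum', sum_eq_single ⟨v, hv⟩]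
    · simp
    · intro b _ hb
      rw [Multiset.count_replicate, if_neg]
      rintro rfl
      exact hb rfl
    · simp
  have cnt' : ∀ (p : ∀ a ∈ s.toFinset, ℕ) (v : ℕ) (_ : v ∉ s.toFinset),
      Multiset.count v (∑ x ∈ s.toFinset.attach, Multiset.replicate (p x.1 x.2) x.1) = 0 := by
    intro p v hv
    rw [Multiset.count_sum', sum_eq_zero]
    rintro ⟨x, hx⟩ _
    rw [Multiset.count_replicate, if_neg]
    rintro rfl
    exact hv hx
  refine sum_bij' (fun c _ v _ => c.count v)
    (fun p _ => ∑ x ∈ s.toFinset.attach, Multiset.replicate (p x.1 x.2) x.1) ?_ ?_ ?_ ?_ ?_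
  · intro c hc
    rw [mem_Iic, Multiset.le_iff_count] at hc
    rw [mem_pi]
    intro v _
    have := hc v
    rw [mem_range]
    omega
  · intro p hp
    rw [mem_pi] at hp
    rw [mem_Iic, Multiset.le_iff_count]
    intro v
    by_cases hv : v ∈ s.toFinset
    · rw [cnt p v hv]
      have := hp v hv
      rw [mem_range] at this
      omega
    · rw [cnt' p v hv]
      exact Nat.zero_le _
  · intro c hc
    rw [mem_Iic, Multiset.le_iff_count] at hc
    ext v
    by_cases hv : v ∈ s.toFinset
    · exact cnt (fun v _ => c.count v) v hv
    · refine (cnt' (fun v _ => c.count v) v hv).trans ?_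
      have := hc v
      rw [Multiset.mem_toFinset, ← Multiset.count_eq_zero] at hv
      omega
  · intro p hp
    funext v hv
    exact cnt p v hv
  · intro c hc
    rw [prod_attach s.toFinset (fun v => F v (c.count v))]

end DoublyAlternating

/-! ### Symmetries of doubly alternating permutations, and standardization -/

namespace DoublyAlternating

open Finset
open scoped Classical

variable {n : ℕ}

/-- Step `i` of the word of the permutation `σ` is a rise. -/
def Asc (σ : Equiv.Perm (Fin n)) (i : ℕ) : Prop :=
  ∃ h : i + 1 < n, σ ⟨i, Nat.lt_of_succ_lt h⟩ < σ ⟨i + 1, h⟩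

lemma not_asc_iff (σ : Equiv.Perm (Fin n)) {i : ℕ} (h : i + 1 < n) :
    ¬ Asc σ i ↔ σ ⟨i + 1, h⟩ < σ ⟨i, Nat.lt_of_succ_lt h⟩ := by
  have hne : σ ⟨i + 1, h⟩ ≠ σ ⟨i, Nat.lt_of_succ_lt h⟩ := fun e => by
    simpa using σ.injective e
  simp only [Asc, h, exists_true_left, not_lt]
  exact ⟨fun h => lt_of_le_of_ne h hne, le_of_lt⟩

lemma isReverseAlternating_iff (σ : Equiv.Perm (Fin n)) :
    IsReverseAlternating σ ↔ Zigzag (Asc σ) 0 n := by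
  refine forall_congr' fun i => forall_congr' fun h => ?_
  rw [← not_asc_iff σ h, zero_add]
  have : Asc σ i ↔ σ ⟨i, Nat.lt_of_succ_lt h⟩ < σ ⟨i + 1, h⟩ := by simp [Asc, h]
  rw [← this, ← Nat.not_even_iff_odd]
  tauto

lemma isAlternating_iff (σ : Equiv.Perm (Fin n)) :
    IsAlternating σ ↔ ∀ i, i + 1 < n → (Asc σ i ↔ Odd i) := by
  refine forall_congr' fun i => forall_congr' fun h => ?_
  rw [← not_asc_iff σ h]
  have : Asc σ i ↔ σ ⟨i, Nat.lt_of_succ_lt h⟩ < σ ⟨i + 1, h⟩ := by simp [Asc, h]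
  rw [← this, ← Nat.not_even_iff_odd]
  tauto

lemma isAlternating_iff_zigzag (k : ℕ) (σ : Equiv.Perm (Fin (2 * k + 2))) :
    IsAlternating σ ↔ ¬ Asc σ 0 ∧ Zigzag (Asc σ) 1 (2 * k + 1) := by
  rw [isAlternating_iff]
  constructor
  · intro h
    refine ⟨by simpa using h 0 (by omega), fun i hi => ?_⟩
    rw [h (1 + i) (by omega), Nat.odd_add, Nat.even_iff]
    simp
  · rintro ⟨h0, h⟩ i hi
    rcases i with _ | i
    · simpa using h0
    · have := h i (by omega)
      rw [add_comm 1 i] at this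
      rw [this, Nat.odd_add_one, Nat.not_odd_iff_even]

lemma asc_revPerm_mul (σ : Equiv.Perm (Fin n)) {i : ℕ} (h : i + 1 < n) :
    Asc (Fin.revPerm * σ) i ↔ ¬ Asc σ i := by
  rw [not_asc_iff σ h]
  simp [Asc, h]

lemma asc_mul_revPerm (σ : Equiv.Perm (Fin n)) {i : ℕ} (h : i + 1 < n) :
    Asc (σ * Fin.revPerm) i ↔ ¬ Asc σ (n - 2 - i) := by
  rw [not_asc_iff σ (by omega)]
  simp only [Asc, h, exists_true_left, Equiv.Perm.mul_apply, Fin.revPerm_apply]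
  rw [show Fin.rev ⟨i, Nat.lt_of_succ_lt h⟩ = ⟨n - 2 - i + 1, by omega⟩ by
      ext; simp [Fin.val_rev]; omega,
    show Fin.rev ⟨i + 1, h⟩ = ⟨n - 2 - i, by omega⟩ by ext; simp [Fin.val_rev]; omega]

lemma isReverseAlternating_revPerm_mul (σ : Equiv.Perm (Fin n)) :
    IsReverseAlternating (Fin.revPerm * σ) ↔ IsAlternating σ := by
  rw [isReverseAlternating_iff, isAlternating_iff]
  refine forall_congr' fun i => forall_congr' fun h => ?_
  rw [zero_add, asc_revPerm_mul σ h, ← Nat.not_even_iff_odd]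
  tauto

lemma isReverseAlternating_mul_revPerm_of_even (hn : Even n) (σ : Equiv.Perm (Fin n)) :
    IsReverseAlternating (σ * Fin.revPerm) ↔ IsAlternating σ := by
  rw [isReverseAlternating_iff, isAlternating_iff]
  rw [Nat.even_iff] at hn
  constructor
  · intro h i hi
    have := h (n - 2 - i) (by omega)
    rw [zero_add, asc_mul_revPerm σ (by omega), show n - 2 - (n - 2 - i) = i by omega] at this
    have e : Even (n - 2 - i) ↔ ¬ Odd i := by rw [Nat.even_iff, Nat.odd_iff]; omega
    tauto
  · intro h i hi
    rw [zero_add, asc_mul_revPerm σ hi, h _ (by omega), Nat.even_iff, Nat.odd_iff]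
    omega

lemma isReverseAlternating_mul_revPerm_of_odd (hn : Odd n) (σ : Equiv.Perm (Fin n)) :
    IsReverseAlternating (σ * Fin.revPerm) ↔ IsReverseAlternating σ := by
  rw [isReverseAlternating_iff, isReverseAlternating_iff]
  rw [Nat.odd_iff] at hn
  constructor
  · intro h i hi
    have := h (n - 2 - i) (by omega)
    rw [zero_add, asc_mul_revPerm σ (by omega), show n - 2 - (n - 2 - i) = i by omega] at this
    rw [zero_add]
    have e : Even (n - 2 - i) ↔ ¬ Even i := by rw [Nat.even_iff, Nat.even_iff]; omega
    tauto
  · intro h i hi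
    have := h (n - 2 - i) (by omega)
    rw [zero_add] at this
    rw [zero_add, asc_mul_revPerm σ hi, this, Nat.even_iff, Nat.even_iff]
    omega

/-- The number of permutations that are, with their inverse, reverse alternating. -/
noncomputable def reverseCount (n : ℕ) : ℕ :=
  #{σ : Equiv.Perm (Fin n) | Zigzag (Asc σ) 0 n ∧ Zigzag (Asc σ⁻¹) 0 n}

lemma natCard_eq_card_filter {α : Type*} [Fintype α] (P : α → Prop) [DecidablePred P] :
    Nat.card {x // P x} = #{x | P x} := by
  rw [Nat.card_eq_fintype_card, Fintype.card_subtype]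

lemma inv_revPerm : (Fin.revPerm : Equiv.Perm (Fin n))⁻¹ = Fin.revPerm := rfl

/-- Complementing `σ` reverses the word of `σ⁻¹`. Reversal exchanges the two kinds of zigzag in even
length, where the number of steps is odd, and preserves them in odd length. So complementation
suffices for even `n`, while odd `n` needs complementation and reversal together. -/
theorem f_eq_reverseCount (n : ℕ) : f n = reverseCount n := by
  rw [f, reverseCount, ← natCard_eq_card_filter]
  rcases Nat.even_or_odd n with hn | hn
  · refine Nat.card_congr ((Equiv.mulLeft Fin.revPerm).subtypeEquiv fun σ => ?_)
    rw [Equiv.coe_mulLeft, ← isReverseAlternating_iff, ← isReverseAlternating_iff, mul_inv_rev,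
      inv_revPerm, isReverseAlternating_revPerm_mul, isReverseAlternating_mul_revPerm_of_even hn]
  · refine Nat.card_congr (((Equiv.mulLeft Fin.revPerm).trans
      (Equiv.mulRight Fin.revPerm)).subtypeEquiv fun σ => ?_)
    rw [Equiv.trans_apply, Equiv.coe_mulLeft, Equiv.coe_mulRight, ← isReverseAlternating_iff,
      ← isReverseAlternating_iff, mul_inv_rev, mul_inv_rev,
      inv_revPerm, ← mul_assoc, isReverseAlternating_mul_revPerm_of_odd hn,
      isReverseAlternating_mul_revPerm_of_odd hn, isReverseAlternating_revPerm_mul,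
      isReverseAlternating_revPerm_mul]

theorem fStar_eq_reverseCount_of_odd (hn : Odd n) : fStar n = reverseCount n := by
  rw [fStar, reverseCount, ← natCard_eq_card_filter]
  refine Nat.card_congr ((Equiv.mulLeft Fin.revPerm).subtypeEquiv fun σ => ?_)
  rw [Equiv.coe_mulLeft, ← isReverseAlternating_iff, ← isReverseAlternating_iff, mul_inv_rev,
    inv_revPerm, isReverseAlternating_revPerm_mul, isReverseAlternating_mul_revPerm_of_odd hn]

/-- `σ` rises along the ties of `β` on the first `p` positions. -/
def RisesOnTies (β : ℕ → ℕ) (p : ℕ) (σ : Equiv.Perm (Fin n)) : Prop :=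
  ∀ i, i + 1 < p → β i = β (i + 1) → Asc σ i

lemma RisesOnTies.lt {β : ℕ → ℕ} (hβ : ∀ i j, i ≤ j → j < n → β i ≤ β j)
    {σ : Equiv.Perm (Fin n)} (hσ : RisesOnTies β n σ) (i j : Fin n) (hij : i < j)
    (h : β i = β j) : σ i < σ j := by
  obtain ⟨i, hi⟩ := i
  obtain ⟨j, hj⟩ := j
  simp only [Fin.mk_lt_mk] at hij h
  induction j, hij using Nat.le_induction with
  | base =>
    obtain ⟨_, h'⟩ := hσ i hj h
    exact h'
  | succ j hij ih =>
    have h1 := hβ i j (by omega) (by omega)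
    have h2 := hβ j (j + 1) (by omega) hj
    obtain ⟨_, h'⟩ := hσ j hj (by omega)
    exact (ih (by omega) (by omega)).trans h'

/-- This is the injectivity of standardization: `σ` is recovered from its word `β ∘ σ⁻¹` as the
stable sorting permutation. -/
lemma RisesOnTies.eq_sort {β : ℕ → ℕ} (hβ : ∀ i j, i ≤ j → j < n → β i ≤ β j)
    {σ : Equiv.Perm (Fin n)} (hσ : RisesOnTies β n σ) :
    σ = Tuple.sort (fun x => β (σ⁻¹ x)) := by
  rw [Tuple.eq_sort_iff]
  constructor
  · intro i j hij
    simpa using hβ i j hij j.2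
  · intro i j hij h
    exact hσ.lt hβ i j hij (by simpa using h)

/-- Equal letters appear in the word in increasing order of their labels, so weak rises of the word
are exactly rises of `σ⁻¹`. -/
lemma RisesOnTies.asc_inv_iff {β : ℕ → ℕ} (hβ : ∀ i j, i ≤ j → j < n → β i ≤ β j)
    {σ : Equiv.Perm (Fin n)} (hσ : RisesOnTies β n σ) {i : ℕ} (hi : i + 1 < n) :
    Asc σ⁻¹ i ↔ wordUp (List.ofFn fun x => β (σ⁻¹ x)) i := by
  rw [wordUp, List.getD_eq_getElem _ _ (by simp; omega), List.getD_eq_getElem _ _ (by simpa),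
    List.getElem_ofFn, List.getElem_ofFn]
  constructor
  · rintro ⟨_, h⟩
    exact hβ _ _ h.le (Fin.is_lt _)
  · intro h
    by_contra hn
    rw [not_asc_iff _ hi] at hn
    have h1 := hβ _ _ hn.le (Fin.is_lt _)
    have := hσ.lt hβ _ _ hn (le_antisymm h1 h)
    simp at this

/-- Permutations that rise on the ties of `β` and whose inverse is a zigzag correspond, by
standardization, to zigzag words. -/
theorem card_risesOnTies {β : ℕ → ℕ} (hβ : ∀ i j, i ≤ j → j < n → β i ≤ β j) :
    #{σ : Equiv.Perm (Fin n) | RisesOnTies β n σ ∧ Zigzag (Asc σ⁻¹) 0 n} =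
      zigzagWords ((Multiset.range n).map β) := by
  have hb : ((List.ofFn fun x : Fin n => β x : List ℕ) : Multiset ℕ) =
      (Multiset.range n).map β := by
    rw [← Multiset.coe_range, Multiset.map_coe]
    congr 1
    apply List.ext_getElem <;> simp
  have zz : ∀ σ : Equiv.Perm (Fin n), RisesOnTies β n σ → (Zigzag (Asc σ⁻¹) 0 n ↔
      Zigzag (wordUp (List.ofFn fun x => β (σ⁻¹ x))) 0 n) := by
    intro σ hσ
    refine forall_congr' fun i => forall_congr' fun h => ?_
    rw [zero_add, hσ.asc_inv_iff hβ h]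
  refine card_bij (fun σ _ => List.ofFn fun x => β (σ⁻¹ x)) ?_ ?_ ?_
  · intro σ hσ
    simp only [mem_filter, mem_univ, true_and] at hσ
    rw [mem_filter, mem_words, Multiset.card_map, Multiset.card_range, ← zz σ hσ.1, ← hb]
    refine ⟨Multiset.coe_eq_coe.2 ?_, hσ.2⟩
    exact Equiv.Perm.ofFn_comp_perm σ⁻¹ (fun x : Fin n => β x)
  · intro σ hσ τ hτ h
    simp only [mem_filter, mem_univ, true_and] at hσ hτ
    have := List.ofFn_injective h
    rw [hσ.1.eq_sort hβ, hτ.1.eq_sort hβ, this]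
  · intro l hl
    rw [mem_filter, Multiset.card_map, Multiset.card_range] at hl
    have hlen : l.length = n := by simpa using length_of_mem_words hl.1
    obtain ⟨u, rfl⟩ : ∃ u : Fin n → ℕ, List.ofFn u = l := by
      subst hlen
      exact ⟨l.get, List.ofFn_get l⟩
    -- Both sides are the increasing arrangement of the same multiset of letters.
    have hu : u ∘ Tuple.sort u = fun x : Fin n => β x := by
      apply List.ofFn_injective
      refine List.Perm.eq_of_sortedLE (Tuple.monotone_sort u).sortedLE_ofFn
        (Monotone.sortedLE_ofFn fun i j hij => hβ i j hij j.2) ?_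
      refine (Equiv.Perm.ofFn_comp_perm _ u).trans (Multiset.coe_eq_coe.1 ?_)
      rw [hb]
      exact mem_words.1 hl.1
    have hu' : ∀ x : Fin n, β x = u (Tuple.sort u x) := fun x => (congrFun hu x).symm
    have hT : RisesOnTies β n (Tuple.sort u) := by
      intro i hi h
      refine ⟨hi, (Tuple.eq_sort_iff.1 rfl).2 _ _ (by simp) ?_⟩
      rw [← hu', ← hu']
      exact h
    have e : (List.ofFn fun x => β ((Tuple.sort u)⁻¹ x)) = List.ofFn u := by
      congr 1
      funext x
      rw [hu']
      simp
    refine ⟨Tuple.sort u, ?_, e⟩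
    rw [mem_filter, zz _ hT, e]
    exact ⟨mem_univ _, hT, hl.2⟩

theorem eulerNumber_eq_zigzagWords (n : ℕ) : eulerNumber n = zigzagWords (Multiset.range n) := by
  have h := card_risesOnTies (n := n) (β := id) (fun i j hij _ => hij)
  rw [Multiset.map_id] at h
  rw [← h, eulerNumber, ← natCard_eq_card_filter]
  refine Nat.card_congr (((Equiv.mulLeft Fin.revPerm).trans
    (Equiv.inv _)).subtypeEquiv fun σ => ?_)
  have ties : ∀ τ : Equiv.Perm (Fin n), RisesOnTies id n τ := fun τ i _ h => by simp at h
  rw [Equiv.trans_apply, Equiv.coe_mulLeft, Equiv.inv_apply, inv_inv, ← isReverseAlternating_iff,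
    isReverseAlternating_revPerm_mul]
  exact (and_iff_right (ties _)).symm

end DoublyAlternating

/-! ### The second inclusion-exclusion, along the permutation itself -/

namespace DoublyAlternating

open Finset Polynomial
open scoped Classical

variable {n : ℕ}

/-- The number of permutations that rise on the ties of `β` on the first `p` positions, are a zigzag
on the remaining ones, and whose inverse is a zigzag. -/
noncomputable def mixedCount (n : ℕ) (β : ℕ → ℕ) (p : ℕ) : ℕ :=
  #{σ : Equiv.Perm (Fin n) |
    RisesOnTies β p σ ∧ Zigzag (Asc σ) p (n - p) ∧ Zigzag (Asc σ⁻¹) 0 n}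

/-- `β` on the first `p` positions, followed by the letter `v`. -/
def extendBy (β : ℕ → ℕ) (p v i : ℕ) : ℕ := if i < p then β i else v

/-- A block of new, larger equal letters encodes a rising run: there is no tie at the joint, and
each tie inside the block forces one rise. -/
lemma risesOnTies_extendBy {β : ℕ → ℕ} {p v : ℕ} (hv : ∀ i < p, β i < v) (k : ℕ)
    (σ : Equiv.Perm (Fin n)) :
    RisesOnTies (extendBy β p v) (p + k) σ ↔ RisesOnTies β p σ ∧ Rises (Asc σ) p k := by
  constructor
  · intro h
    refine ⟨fun i hi hβ => h i (by omega) ?_, fun i hi => h (p + i) (by omega) ?_⟩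
    · simp [extendBy, hi, Nat.lt_of_succ_lt hi, hβ]
    · simp [extendBy, show ¬ p + i + 1 < p by omega]
  · rintro ⟨h1, h2⟩ i hi hβ
    rcases lt_trichotomy (i + 1) p with h | h | h
    · refine h1 i h ?_
      simpa [extendBy, h, Nat.lt_of_succ_lt h] using hβ
    · have := hv i (by omega)
      simp [extendBy, show i < p by omega, show ¬ i + 1 < p by omega] at hβ
      omega
    · have := h2 (i - p) (by omega)
      rwa [show p + (i - p) = i by omega] at this

lemma extendBy_mono {β : ℕ → ℕ} {p v : ℕ} (hβ : ∀ i j, i ≤ j → j < p → β i ≤ β j)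
    (hv : ∀ i < p, β i < v) (i j : ℕ) (hij : i ≤ j) : extendBy β p v i ≤ extendBy β p v j := by
  simp only [extendBy]
  split_ifs with h1 h2
  · exact hβ i j hij h2
  · exact (hv i h1).le
  · omega
  · exact le_rfl

lemma map_extendBy (β : ℕ → ℕ) (p v k : ℕ) :
    (Multiset.range (p + k)).map (extendBy β p v) =
      (Multiset.range p).map β + Multiset.replicate k v := by
  rw [Multiset.range_add, Multiset.map_add, Multiset.map_map]
  congr 1
  · refine Multiset.map_congr rfl fun i hi => ?_
    simp [extendBy, Multiset.mem_range.1 hi]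
  · rw [Multiset.eq_replicate]
    simp [extendBy]

/-- The product of `g` over the multiplicities of the multiset `s`. -/
noncomputable def weight (g : ℕ → ℚ[X]) (s : Multiset ℕ) : ℚ[X] :=
  ∏ v ∈ s.toFinset, g (s.count v)

lemma weight_zero (g : ℕ → ℚ[X]) : weight g 0 = 1 := by simp [weight]

lemma weight_add_replicate {g : ℕ → ℚ[X]} (hg : g 0 = 1) {s : Multiset ℕ} {v : ℕ} (hv : v ∉ s)
    (k : ℕ) : weight g (s + Multiset.replicate k v) = weight g s * g k := by
  rcases Nat.eq_zero_or_pos k with rfl | hk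
  · simp [hg]
  · have : (s + Multiset.replicate k v).toFinset = insert v s.toFinset := by
      ext x
      simp [hk.ne']
    rw [weight, this, prod_insert (by simpa using hv), mul_comm, weight]
    congr 1
    · refine prod_congr rfl fun x hx => ?_
      rw [Multiset.count_add, Multiset.count_replicate, if_neg, add_zero]
      rintro rfl
      exact hv (by simpa using hx)
    · rw [Multiset.count_add, Multiset.count_eq_zero_of_notMem hv, Multiset.count_replicate_self,
        zero_add]

lemma mixedCount_extendBy (β : ℕ → ℕ) (p v k m : ℕ) (hv : ∀ i < p, β i < v) (h : p + m = n) :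
    mixedCount n (extendBy β p v) (p + k) =
      #{σ ∈ {σ : Equiv.Perm (Fin n) | RisesOnTies β p σ ∧ Zigzag (Asc σ⁻¹) 0 n} |
        Rises (Asc σ) p k ∧ Zigzag (Asc σ) (p + k) (m - k)} := by
  rw [mixedCount, filter_filter]
  congr 1
  ext σ
  simp only [mem_filter, mem_univ, true_and]
  rw [risesOnTies_extendBy hv, show n - (p + k) = m - k by omega]
  tauto

lemma neg_one_pow_mul_self (a : ℕ) : (-1 : ℚ) ^ a * (-1) ^ a = 1 := by
  rw [← pow_add]
  exact Even.neg_one_pow ⟨a, rfl⟩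

/-- If zigzag words are counted by the functional `Φ` on the products of the `g j`, then mixed
permutations are counted by `Φ` with an additional factor `q m`, where `q` is the quotient of
the even part of `g` into `1` plus its odd part. -/
theorem mixedCount_eq (Φ : ℚ[X] →ₗ[ℚ] ℚ) (g q : ℕ → ℚ[X]) (hg : g 0 = 1)
    (hw : ∀ s : Multiset ℕ, Multiset.card s = n → (signedZigzagWords s : ℚ) = Φ (weight g s))
    (hq : ∀ m, ∑ j ∈ range (m / 2 + 1), g (2 * j) * q (m - 2 * j) =
      if Even m then (if m = 0 then 1 else 0) else g m)
    (m : ℕ) : ∀ (p : ℕ) (β : ℕ → ℕ), p + m = n → (∀ i j, i ≤ j → j < p → β i ≤ β j) →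
      (mixedCount n β p : ℚ) =
        (-1) ^ (m / 2 + n / 2) * Φ (weight g ((Multiset.range p).map β) * q m) := by
  have q0 : q 0 = 1 := by simpa [hg] using hq 0
  induction m using Nat.strong_induction_on with
  | _ m ih =>
  intro p β hp hβ
  rcases Nat.eq_zero_or_pos m with rfl | hm
  · obtain rfl : p = n := hp
    have hs := hw ((Multiset.range p).map β) (by simp)
    rw [signedZigzagWords, Multiset.card_map, Multiset.card_range, ← card_risesOnTies hβ] at hs
    push_cast at hs
    rw [q0, mul_one, ← hs, Nat.zero_div, zero_add, ← mul_assoc, neg_one_pow_mul_self, one_mul,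
      mixedCount]
    congr 2
    ext σ
    simp [zigzag_zero]
  -- A letter above all previous ones keeps `β` sorted and makes the weight gain exactly the factor
  -- `g k`.
  · obtain ⟨v, hv⟩ : ∃ v, ∀ i < p, β i < v :=
      ⟨(range p).sup β + 1, fun i hi =>
        Nat.lt_succ_of_le (le_sup (f := β) (mem_range.2 hi))⟩
    set B : Finset (Equiv.Perm (Fin n)) := {σ | RisesOnTies β p σ ∧ Zigzag (Asc σ⁻¹) 0 n} with hB
    set W := weight g ((Multiset.range p).map β) with hW
    have hvs : v ∉ (Multiset.range p).map β := by
      intro h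
      obtain ⟨i, hi, h⟩ := Multiset.mem_map.1 h
      exact (hv i (Multiset.mem_range.1 hi)).ne h
    have hmix : ∀ k ≤ m, 0 < k → (mixedCount n (extendBy β p v) (p + k) : ℚ) =
        (-1) ^ ((m - k) / 2 + n / 2) * Φ (W * (g k * q (m - k))) := by
      intro k hk hk0
      rw [ih (m - k) (by omega) (p + k) (extendBy β p v) (by omega)
        (fun i j hij _ => extendBy_mono hβ hv i j hij), map_extendBy,
        weight_add_replicate hg hvs, mul_assoc]
    have h := sum_congr (rfl : B = B) fun σ _ => sum_ind_rises_zigzag (Asc σ) p m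
    rw [sum_comm] at h
    simp only [← mul_sum, sum_ind_eq_card] at h
    have h0 : mixedCount n β p = mixedCount n (extendBy β p v) (p + 2 * 0) := by
      rw [mixedCount, mixedCount]
      congr 1
      ext σ
      simp only [mem_filter, mem_univ, true_and]
      rw [risesOnTies_extendBy hv]
      simp [rises_zero]
    simp only [hB, ← mixedCount_extendBy β p v _ m hv hp] at h
    rw [sum_range_succ', ← h0, pow_zero, one_mul] at h
    have hR : ((∑ σ ∈ B, if Even m then (if m = 0 then (1 : ℤ) else 0) else
        (-1) ^ (m / 2) * ind (Rises (Asc σ) p m) : ℤ) : ℚ) = (-1) ^ (m / 2 + n / 2) *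
        Φ (W * if Even m then (if m = 0 then 1 else 0) else g m) := by
      by_cases hev : Even m
      · simp [hev, hm.ne']
      · simp only [if_neg hev]
        rw [← mul_sum, sum_ind_eq_card]
        have e : #{σ ∈ B | Rises (Asc σ) p m} = mixedCount n (extendBy β p v) (p + m) := by
          rw [mixedCount_extendBy β p v m m hv hp]
          congr 1
          ext σ
          simp [zigzag_zero, hB]
        rw [e]
        push_cast
        rw [hmix m le_rfl hm, Nat.sub_self, q0, mul_one, Nat.zero_div, zero_add, pow_add, mul_assoc]
    -- The relation for `q` mirrors the inclusion-exclusion term by term. The terms with a nonempty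
    -- rising block agree by induction, so the remaining ones, `mixedCount n β p` and its signed
    -- value of `Φ`, agree as well.
    have hq' := hq m
    rw [sum_range_succ', mul_zero, hg, one_mul, Nat.sub_zero] at hq'
    rw [← hq', mul_add, map_add, mul_add, mul_sum, map_sum, mul_sum] at hR
    have hL : ∀ j ∈ range (m / 2), (((-1) ^ (j + 1) *
        (mixedCount n (extendBy β p v) (p + 2 * (j + 1)) : ℤ) : ℤ) : ℚ) =
        (-1) ^ (m / 2 + n / 2) * Φ (W * (g (2 * (j + 1)) * q (m - 2 * (j + 1)))) := by
      intro j hj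
      rw [mem_range] at hj
      push_cast
      rw [hmix _ (by omega) (by omega), ← mul_assoc, ← pow_add]
      congr 1
      apply neg_one_pow_congr
      rw [show (m - 2 * (j + 1)) / 2 = m / 2 - (j + 1) by omega]
      simp only [Nat.even_iff]
      omega
    have hfin := congrArg (fun z : ℤ => (z : ℚ)) h
    rw [hR] at hfin
    rw [Int.cast_add, Int.cast_sum, sum_congr rfl hL] at hfin
    simpa using hfin

/-- The number of permutations that are, with their inverse, alternating. -/
theorem f_eq_of_functional (Φ : ℚ[X] →ₗ[ℚ] ℚ) (g q : ℕ → ℚ[X]) (hg : g 0 = 1)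
    (hw : ∀ s : Multiset ℕ, Multiset.card s = n → (signedZigzagWords s : ℚ) = Φ (weight g s))
    (hq : ∀ m, ∑ j ∈ range (m / 2 + 1), g (2 * j) * q (m - 2 * j) =
      if Even m then (if m = 0 then 1 else 0) else g m) : (f n : ℚ) = Φ (q n) := by
  have h := mixedCount_eq Φ g q hg hw hq n 0 id (by omega) (fun i j _ hj => by omega)
  rw [Multiset.range_zero, Multiset.map_zero, weight_zero, one_mul, pow_add,
    neg_one_pow_mul_self, one_mul] at h
  rw [f_eq_reverseCount, ← h, reverseCount, mixedCount]
  congr 2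
  ext σ
  simp [RisesOnTies]

/-- As σ starts with a fall, the rising blocks in `sum_ind_rises_zigzag_fall` have odd length, and
the fully rising word contributes the separate term `g (2 * k + 2)`. -/
theorem fStar_eq_of_functional (k : ℕ) (Φ : ℚ[X] →ₗ[ℚ] ℚ) (g q : ℕ → ℚ[X]) (hg : g 0 = 1)
    (hw : ∀ s : Multiset ℕ, Multiset.card s = 2 * k + 2 →
      (signedZigzagWords s : ℚ) = Φ (weight g s))
    (hq : ∀ m, ∑ j ∈ range (m / 2 + 1), g (2 * j) * q (m - 2 * j) =
      if Even m then (if m = 0 then 1 else 0) else g m) :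
    (fStar (2 * k + 2) : ℚ) =
      Φ (g (2 * k + 2) - ∑ j ∈ range (k + 1), g (2 * j + 1) * q (2 * k + 1 - 2 * j)) := by
  have q0 : q 0 = 1 := by simpa [hg] using hq 0
  have h0 : ∀ i < 0, id i < 0 := fun i hi => by omega
  have hmix : ∀ i ≤ 2 * k + 2, (mixedCount (2 * k + 2) (extendBy id 0 0) (0 + i) : ℚ) =
      (-1) ^ ((2 * k + 2 - i) / 2 + (2 * k + 2) / 2) * Φ (g i * q (2 * k + 2 - i)) := by
    intro i hi
    rw [mixedCount_eq Φ g q hg hw hq (2 * k + 2 - i) (0 + i) (extendBy id 0 0) (by omega)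
      (fun i j hij _ => extendBy_mono (fun i j _ hj => by omega) h0 i j hij), map_extendBy,
      weight_add_replicate hg (by simp)]
    simp [weight_zero]
  set B : Finset (Equiv.Perm (Fin (2 * k + 2))) :=
    {σ | RisesOnTies id 0 σ ∧ Zigzag (Asc σ⁻¹) 0 (2 * k + 2)} with hB
  have h := sum_congr (rfl : B = B) fun σ _ => sum_ind_rises_zigzag_fall (Asc σ) 0 k
  rw [sum_comm, sum_add_distrib] at h
  simp only [← mul_sum, sum_ind_eq_card] at h
  have e1 : #{σ ∈ B | ¬ Asc σ 0 ∧ Zigzag (Asc σ) (0 + 1) (2 * k + 1)} = fStar (2 * k + 2) := by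
    rw [fStar, natCard_eq_card_filter, hB, filter_filter]
    congr 1
    ext σ
    simp only [mem_filter, mem_univ, true_and]
    rw [isAlternating_iff_zigzag, isReverseAlternating_iff, zero_add]
    have : RisesOnTies id 0 σ := fun i hi => by omega
    tauto
  have e2 : #{σ ∈ B | Rises (Asc σ) 0 (2 * k + 2)} =
      mixedCount (2 * k + 2) (extendBy id 0 0) (0 + (2 * k + 2)) := by
    rw [mixedCount_extendBy id 0 0 _ (2 * k + 2) h0 (by omega)]
    congr 1
    ext σ
    simp [zigzag_zero, hB]
  have e3 : ∀ j, #{σ ∈ B | Rises (Asc σ) 0 (2 * j + 1) ∧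
      Zigzag (Asc σ) (0 + 2 * j + 1) (2 * k + 1 - 2 * j)} =
      mixedCount (2 * k + 2) (extendBy id 0 0) (0 + (2 * j + 1)) := by
    intro j
    rw [mixedCount_extendBy id 0 0 _ (2 * k + 2) h0 (by omega), ← add_assoc,
      show 2 * k + 2 - (2 * j + 1) = 2 * k + 1 - 2 * j by omega]
  simp only [e1, e2, e3] at h
  have hfin := congrArg (fun z : ℤ => (z : ℚ)) h
  push_cast at hfin
  rw [hmix _ le_rfl, Nat.sub_self, q0, mul_one, Nat.zero_div, zero_add,
    show (2 * k + 2) / 2 = k + 1 by omega, pow_succ] at hfin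
  -- The exponents `j`, `k - j` and `k + 1` add up to an odd number, hence the minus sign.
  have hL : ∀ j ∈ range (k + 1), (-1 : ℚ) ^ j *
      (mixedCount (2 * k + 2) (extendBy id 0 0) (0 + (2 * j + 1)) : ℚ) =
      - Φ (g (2 * j + 1) * q (2 * k + 1 - 2 * j)) := by
    intro j hj
    rw [mem_range] at hj
    rw [hmix _ (by omega), show 2 * k + 2 - (2 * j + 1) = 2 * k + 1 - 2 * j by omega, ← mul_assoc,
      ← pow_add, Odd.neg_one_pow, neg_one_mul]
    rw [Nat.odd_iff]
    omega
  rw [sum_congr rfl hL, sum_neg_distrib] at hfin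
  rw [map_sub, map_sum]
  have e4 : (-1 : ℚ) ^ k * ((-1) ^ k * -1 * Φ (g (2 * k + 2))) = - Φ (g (2 * k + 2)) := by
    rw [mul_assoc, ← mul_assoc, neg_one_pow_mul_self]
    ring
  rw [e4] at hfin
  linarith

end DoublyAlternating

/-! ### Euler numbers and the moment functionals of sech and tanh -/

namespace DoublyAlternating

open Finset
open scoped Classical

/-- Zigzag words without repeated letters are counted by the Euler numbers. -/
theorem zigzagWords_of_nodup {s : Multiset ℕ} (hs : s.Nodup) :
    zigzagWords s = eulerNumber (Multiset.card s) := by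
  set n := Multiset.card s with hn
  set l := s.sort (· ≤ ·) with hl
  have hlen : l.length = n := by simp [hl, hn]
  have hsorted : l.Pairwise (· < ·) := by
    have h1 : l.Pairwise (· ≤ ·) := Multiset.pairwise_sort _ _
    have h2 : l.Nodup := by rw [← Multiset.coe_nodup, hl, Multiset.sort_eq]; exact hs
    exact (h1.and h2).imp fun h => lt_of_le_of_ne h.1 h.2
  set β : ℕ → ℕ := fun i => l.getD i 0 with hβdef
  have hlt : ∀ i j, i < j → j < n → β i < β j := by
    intro i j hij hj
    simp only [hβdef]
    rw [List.getD_eq_getElem _ _ (by omega), List.getD_eq_getElem _ _ (by omega)]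
    exact List.pairwise_iff_getElem.1 hsorted i j _ _ hij
  have hβ : ∀ i j, i ≤ j → j < n → β i ≤ β j := by
    intro i j hij hj
    rcases hij.lt_or_eq with h | rfl
    · exact (hlt i j h hj).le
    · exact le_rfl
  have hmap : (Multiset.range n).map β = s := by
    rw [← Multiset.sort_eq s (· ≤ ·), ← hl, ← Multiset.coe_range, Multiset.map_coe]
    congr 1
    apply List.ext_getElem
    · simp [hlen]
    · intro i h1 h2
      simp [hβdef, List.getElem?_eq_getElem h2]
  have h := card_risesOnTies hβ
  rw [hmap] at h
  rw [← h, eulerNumber_eq_zigzagWords, ← Multiset.map_id (Multiset.range n),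
    ← card_risesOnTies (n := n) (β := id) (fun i j hij _ => hij)]
  congr 1
  ext σ
  -- Without repeated letters there are no ties, so neither condition restricts `σ`.
  have t1 : RisesOnTies β n σ := fun i hi h => absurd h (hlt i (i + 1) (by omega) hi).ne
  have t2 : RisesOnTies id n σ := fun i _ h => by simp at h
  simp [t1, t2]

/-- The Euler number `Eₙ` with the sign `(-1)^⌊n/2⌋`. -/
noncomputable def signedEuler (n : ℕ) : ℚ := (-1) ^ (n / 2) * eulerNumber n

lemma signedEuler_sq (n : ℕ) : signedEuler n * signedEuler n = (eulerNumber n : ℚ) ^ 2 := by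
  rw [signedEuler, mul_mul_mul_comm, neg_one_pow_mul_self, one_mul, sq]

lemma signedZigzagWords_of_nodup {s : Multiset ℕ} (hs : s.Nodup) :
    (signedZigzagWords s : ℚ) = signedEuler (Multiset.card s) := by
  rw [signedZigzagWords, zigzagWords_of_nodup hs, signedEuler]
  push_cast
  rfl

/-- The recursion for the Euler numbers. -/
theorem sum_choose_signedEuler (n : ℕ) :
    ∑ j ∈ range (n + 1), (n.choose j : ℚ) * (if Even j then signedEuler (n - j) else 0) =
      if Even n then (if n = 0 then 1 else 0) else 1 := by
  have h := congrArg (fun z : ℤ => (z : ℚ)) (sum_signedZigzagWords (Multiset.range n))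
  rw [Multiset.card_range] at h
  have hr : (if Even n then (if Multiset.range n = 0 then (1 : ℤ) else 0) else 1) =
      if Even n then (if n = 0 then 1 else 0) else 1 := by
    have : Multiset.range n = 0 ↔ n = 0 := by rw [← Multiset.card_eq_zero, Multiset.card_range]
    simp only [this]
  rw [hr] at h
  push_cast at h
  rw [← h, sum_filter]
  have e := sum_powerset_apply_card
    (fun j => if Even j then signedEuler (n - j) else 0) (x := range n)
  rw [card_range] at e
  simp only [nsmul_eq_mul] at e
  rw [← e]
  -- Sub-multisets of a multiset without repetitions are subsets, so the recursion for words becomes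
  -- a binomial one.
  refine sum_bij' (fun t _ => t.val) (fun c _ => c.toFinset) ?_ ?_ ?_ ?_ ?_
  · intro t ht
    rw [mem_powerset] at ht
    rw [mem_Iic]
    exact Finset.val_le_iff.2 ht
  · intro c hc
    rw [mem_Iic] at hc
    rw [mem_powerset]
    intro x hx
    exact Multiset.mem_of_le hc (by simpa using hx)
  · intro t _
    simp
  · intro c hc
    rw [mem_Iic] at hc
    exact Multiset.dedup_eq_self.2 (Multiset.nodup_of_le hc (Multiset.nodup_range n))
  · intro t ht
    rw [mem_powerset] at ht
    have hle : t.val ≤ Multiset.range n := Finset.val_le_iff.2 ht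
    rw [Finset.card_val, signedZigzagWords_of_nodup
      (Multiset.nodup_of_le tsub_le_self (Multiset.nodup_range n)), Multiset.card_sub hle,
      Multiset.card_range, Finset.card_val]

open Polynomial

/-- The linear functional on polynomials with `y ^ n ↦ a n`. -/
noncomputable def momentFunctional (a : ℕ → ℚ) : ℚ[X] →ₗ[ℚ] ℚ :=
  Polynomial.lsum fun n => a n • LinearMap.id

lemma momentFunctional_C_mul_X_pow (a : ℕ → ℚ) (c : ℚ) (n : ℕ) :
    momentFunctional a (C c * X ^ n) = c * a n := by
  rw [C_mul_X_pow_eq_monomial, momentFunctional, Polynomial.lsum_apply,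
    Polynomial.sum_monomial_index] <;> simp [mul_comm]

lemma momentFunctional_natCast_mul_X_pow (a : ℕ → ℚ) (c n : ℕ) :
    momentFunctional a (X ^ n * (c : ℚ[X])) = c * a n := by
  rw [← momentFunctional_C_mul_X_pow, mul_comm]
  simp

/-- The coefficients of `sech`, times `n!`. -/
noncomputable def sechMoment (n : ℕ) : ℚ := if Even n then signedEuler n else 0

/-- The coefficients of `tanh`, times `n!`. -/
noncomputable def tanhMoment (n : ℕ) : ℚ := if Even n then 0 else signedEuler n

/-- Only even `j` contribute, so the recursion never mixes parities and can be restricted to either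
one. -/
lemma sum_choose_moment (a : ℕ → ℚ) (b : Bool)
    (ha : ∀ n, a n = if (Even n ↔ b) then signedEuler n else 0) (n : ℕ) :
    ∑ j ∈ range (n + 1), (n.choose j : ℚ) * (if Even j then a (n - j) else 0) =
      if (Even n ↔ b) then (if Even n then (if n = 0 then 1 else 0) else 1) else 0 := by
  rw [← sum_choose_signedEuler n]
  by_cases hn : (Even n ↔ b)
  · rw [if_pos hn]
    refine sum_congr rfl fun j hj => ?_
    rw [mem_range] at hj
    split_ifs with h
    · rw [ha, if_pos]
      rw [← hn, Nat.even_sub (by omega)]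
      tauto
    · rfl
  · rw [if_neg hn]
    refine sum_eq_zero fun j hj => ?_
    rw [mem_range] at hj
    split_ifs with h
    · rw [ha, if_neg, mul_zero]
      rw [Nat.even_sub (by omega)]
      tauto
    · simp

lemma sum_choose_sechMoment (n : ℕ) :
    ∑ j ∈ range (n + 1), (n.choose j : ℚ) * (if Even j then sechMoment (n - j) else 0) =
      if n = 0 then 1 else 0 := by
  rw [sum_choose_moment sechMoment true (by simp [sechMoment])]
  by_cases h : Even n
  · simp [h]
  · have : n ≠ 0 := by rintro rfl; simp at h
    simp [h, this]

lemma sum_choose_tanhMoment (n : ℕ) :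
    ∑ j ∈ range (n + 1), (n.choose j : ℚ) * (if Even j then tanhMoment (n - j) else 0) =
      if Even n then 0 else 1 := by
  rw [sum_choose_moment tanhMoment false (by intro n; by_cases h : Even n <;> simp [tanhMoment, h])]
  by_cases h : Even n <;> simp [h]

/-- The umbral form of multiplication by cosh: the odd powers of the shift cancel in the binomial
expansions of `(X + 1) ^ n` and `(X - 1) ^ n`. -/
lemma momentFunctional_comp_add (a : ℕ → ℚ) (b : ℕ → ℚ)
    (h : ∀ n, ∑ j ∈ range (n + 1), (n.choose j : ℚ) * (if Even j then a (n - j) else 0) = b n)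
    (P : ℚ[X]) :
    momentFunctional a (P.comp (X + 1)) + momentFunctional a (P.comp (X - 1)) =
      2 * momentFunctional b P := by
  induction P using Polynomial.induction_on' with
  | add p q hp hq =>
    simp only [add_comp, map_add] at *
    linear_combination hp + hq
  | monomial n c =>
    rw [← C_mul_X_pow_eq_monomial, momentFunctional_C_mul_X_pow, ← h n]
    simp only [mul_comp, C_comp, pow_comp, X_comp]
    have e : ∀ z : ℚ, momentFunctional a (C c * (X + C z) ^ n) =
        c * ∑ j ∈ range (n + 1), (n.choose j : ℚ) * (z ^ j * a (n - j)) := by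
      intro z
      rw [← smul_eq_C_mul, map_smul, smul_eq_mul, add_comm, add_pow, map_sum]
      congr 1
      refine sum_congr rfl fun j _ => ?_
      rw [← C_pow, mul_assoc, ← smul_eq_C_mul, map_smul, momentFunctional_natCast_mul_X_pow,
        smul_eq_mul]
      ring
    have e1 := e 1
    have e2 := e (-1)
    rw [C_1] at e1
    rw [C_neg, C_1, ← sub_eq_add_neg] at e2
    rw [e1, e2, ← mul_add, ← sum_add_distrib, mul_left_comm, mul_sum _ _ (2 : ℚ)]
    congr 1
    refine sum_congr rfl fun j _ => ?_
    rcases Nat.even_or_odd j with hj | hj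
    · rw [if_pos hj, hj.neg_one_pow]; ring
    · rw [if_neg (by simpa using hj), hj.neg_one_pow]; ring

lemma momentFunctional_eq_of_monomial {Ψ : ℚ[X] →ₗ[ℚ] ℚ} {a : ℕ → ℚ} (h : ∀ n, Ψ (X ^ n) = a n)
    (P : ℚ[X]) : momentFunctional a P = Ψ P := by
  induction P using Polynomial.induction_on' with
  | add p q hp hq => rw [map_add, map_add, hp, hq]
  | monomial n c =>
    rw [← C_mul_X_pow_eq_monomial, momentFunctional_C_mul_X_pow, ← smul_eq_C_mul, map_smul, h,
      smul_eq_mul]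

/-- This is cosh · sech = 1, the series 1 being that of evaluation at 0. -/
theorem sechFunctional_comp (P : ℚ[X]) :
    momentFunctional sechMoment (P.comp (X + 1)) + momentFunctional sechMoment (P.comp (X - 1)) =
      2 * P.eval 0 := by
  rw [momentFunctional_comp_add _ _ sum_choose_sechMoment,
    momentFunctional_eq_of_monomial (Ψ := leval 0) (fun n => by simp [leval, zero_pow_eq])]
  rfl

/-- This is cosh · tanh = sinh, the moments of sinh being half the difference of the evaluations at
1 and -1. -/
theorem tanhFunctional_comp (P : ℚ[X]) :
    momentFunctional tanhMoment (P.comp (X + 1)) + momentFunctional tanhMoment (P.comp (X - 1)) =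
      P.eval 1 - P.eval (-1) := by
  rw [momentFunctional_comp_add _ _ sum_choose_tanhMoment,
    momentFunctional_eq_of_monomial (Ψ := (2⁻¹ : ℚ) • (leval 1 - leval (-1)))]
  · simp [leval]
  · intro n
    rcases Nat.even_or_odd n with hn | hn
    · simp [leval, hn, hn.neg_one_pow]
    · have : ¬ Even n := by simpa using hn
      simp [leval, this, hn.neg_one_pow]
      norm_num

/-- Summing a weight over the complements of the sub-multisets of even size. -/
theorem sum_weight_sub {g hp hm : ℕ → ℚ[X]} (hg : g 0 = 1)
    (h1 : ∀ m, ∑ j ∈ range (m + 1), g (m - j) = hp m)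
    (h2 : ∀ m, ∑ j ∈ range (m + 1), (-1) ^ j * g (m - j) = hm m) (s : Multiset ℕ) :
    2 * ∑ c ∈ Iic s with Even (Multiset.card c), weight g (s - c) =
      weight hp s + weight hm s := by
  have hw : ∀ c ∈ Iic s, weight g (s - c) = ∏ v ∈ s.toFinset, g (s.count v - c.count v) := by
    intro c _
    rw [weight]
    simp only [Multiset.count_sub]
    apply prod_subset
    · exact Multiset.toFinset_subset.2 (Multiset.subset_of_le tsub_le_self)
    · intro v _ hv
      rw [Multiset.mem_toFinset, ← Multiset.count_eq_zero, Multiset.count_sub] at hv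
      rw [hv, hg]
  have hcard : ∀ c ∈ Iic s, (-1 : ℚ[X]) ^ Multiset.card c =
      ∏ v ∈ s.toFinset, (-1 : ℚ[X]) ^ c.count v := by
    intro c hc
    rw [mem_Iic] at hc
    rw [prod_pow_eq_pow_sum, Multiset.sum_count_eq_card]
    intro v hv
    simpa using Multiset.mem_of_le hc hv
  -- Restriction to even sizes is half the sum of the plain and the signed sums, and each of these
  -- factors over the letters.
  have e1 : ∑ c ∈ Iic s, weight g (s - c) = weight hp s := by
    rw [sum_congr rfl hw, sum_Iic_prod_count s (fun v j => g (s.count v - j)), weight]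
    exact prod_congr rfl fun v _ => h1 _
  have e2 : ∑ c ∈ Iic s, (-1) ^ Multiset.card c * weight g (s - c) = weight hm s := by
    rw [sum_congr rfl fun c hc => by rw [hw c hc, hcard c hc, ← prod_mul_distrib],
      sum_Iic_prod_count s (fun v j => (-1) ^ j * g (s.count v - j)), weight]
    exact prod_congr rfl fun v _ => h2 _
  rw [← e1, ← e2, ← sum_add_distrib, sum_filter, mul_sum]
  refine sum_congr rfl fun c _ => ?_
  rcases Nat.even_or_odd (Multiset.card c) with hc | hc
  · rw [if_pos hc, hc.neg_one_pow]; ring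
  · rw [if_neg (by simpa using hc), hc.neg_one_pow]; ring

/-- A function on multisets is determined, on the multisets with a size of given parity, by its sums
over the complements of the sub-multisets of even size. -/
theorem eq_of_sum_Iic_even_eq (b : Bool) (F H : Multiset ℕ → ℚ)
    (h : ∀ s : Multiset ℕ, (Even (Multiset.card s) ↔ b) →
      ∑ c ∈ Iic s with Even (Multiset.card c), F (s - c) =
        ∑ c ∈ Iic s with Even (Multiset.card c), H (s - c)) :
    ∀ s : Multiset ℕ, (Even (Multiset.card s) ↔ b) → F s = H s := by
  intro s
  induction s using Multiset.strongInductionOn with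
  | _ s ih =>
  intro hs
  -- The term `c = 0` is the value at `s`; all others sit at smaller multisets with size of the same
  -- parity.
  have h0 : (0 : Multiset ℕ) ∈ {c ∈ Iic s | Even (Multiset.card c)} := by simp
  have := h s hs
  rw [← add_sum_erase _ _ h0, ← add_sum_erase _ _ h0, tsub_zero,
    sum_congr rfl fun c hc => ih (s - c) ?_ ?_] at this
  · exact add_right_cancel this
  · simp only [mem_erase, mem_filter, mem_Iic] at hc
    refine lt_of_le_of_ne tsub_le_self fun e => hc.1 ?_
    have h1 := congrArg Multiset.card e
    rw [Multiset.card_sub hc.2.1] at h1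
    have h2 := Multiset.card_le_card hc.2.1
    rw [← Multiset.card_eq_zero]
    rcases Nat.eq_zero_or_pos (Multiset.card c) with h3 | h3
    · exact h3
    · omega
  · simp only [mem_erase, mem_filter, mem_Iic] at hc
    rw [Multiset.card_sub hc.2.1, Nat.even_sub (Multiset.card_le_card hc.2.1), ← hs]
    tauto

lemma weight_comp (g : ℕ → ℚ[X]) (P : ℚ[X]) (s : Multiset ℕ) :
    weight (fun m => (g m).comp P) s = (weight g s).comp P := by
  rw [weight, weight, Polynomial.prod_comp]

/-- Zigzag words of even length, counted by the functional with the moments of `sech`. -/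
theorem signedZigzagWords_of_even {g e : ℕ → ℚ[X]} (hg : g 0 = 1)
    (h1 : ∀ m, ∑ j ∈ range (m + 1), g (m - j) = (e m).comp (X + 1))
    (h2 : ∀ m, ∑ j ∈ range (m + 1), (-1) ^ j * g (m - j) = (e m).comp (X - 1))
    (h3 : ∀ m, (e m).eval 0 = if m = 0 then 1 else 0)
    {s : Multiset ℕ} (hs : Even (Multiset.card s)) :
    (signedZigzagWords s : ℚ) = momentFunctional sechMoment (weight g s) := by
  refine eq_of_sum_Iic_even_eq true (fun s => (signedZigzagWords s : ℚ))
    (fun s => momentFunctional sechMoment (weight g s)) (fun s hs => ?_) s (by simpa using hs)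
  have h := congrArg (momentFunctional sechMoment) (sum_weight_sub hg h1 h2 s)
  rw [weight_comp, weight_comp, map_add, sechFunctional_comp, two_mul, map_add, ← two_mul,
    mul_right_inj' two_ne_zero, map_sum] at h
  rw [h, ← Int.cast_sum, sum_signedZigzagWords, if_pos (by simpa using hs), weight, eval_prod]
  by_cases h0 : s = 0
  · simp [h0]
  · obtain ⟨v, hv⟩ := Multiset.exists_mem_of_ne_zero h0
    rw [if_neg h0, prod_eq_zero (Multiset.mem_toFinset.2 hv), Int.cast_zero]
    rw [h3, if_neg (Multiset.count_ne_zero.2 hv)]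

/-- Zigzag words of odd length, counted by the functional with the moments of `tanh`. -/
theorem signedZigzagWords_of_odd {g e : ℕ → ℚ[X]} (hg : g 0 = 1)
    (h1 : ∀ m, ∑ j ∈ range (m + 1), g (m - j) = (e m).comp (X + 1))
    (h2 : ∀ m, ∑ j ∈ range (m + 1), (-1) ^ j * g (m - j) = (e m).comp (X - 1))
    (h3 : ∀ m, (e m).eval 1 = 1) (h4 : ∀ m, (e m).eval (-1) = (-1) ^ m)
    {s : Multiset ℕ} (hs : ¬ Even (Multiset.card s)) :
    (signedZigzagWords s : ℚ) = momentFunctional tanhMoment (weight g s) := by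
  refine eq_of_sum_Iic_even_eq false (fun s => (signedZigzagWords s : ℚ))
    (fun s => momentFunctional tanhMoment (weight g s)) (fun s hs => ?_) s (by simpa using hs)
  have hs' : ¬ Even (Multiset.card s) := by simpa using hs
  have h := congrArg (momentFunctional tanhMoment) (sum_weight_sub hg h1 h2 s)
  rw [weight_comp, weight_comp, map_add, tanhFunctional_comp, two_mul, map_add, ← two_mul,
    map_sum, weight, eval_prod, eval_prod] at h
  simp only [h3, h4, prod_const_one] at h
  -- The values at -1 multiply to `(-1) ^ card s = -1`, so the difference of evaluations is 2.
  rw [prod_pow_eq_pow_sum, Multiset.toFinset_sum_count_eq,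
    (Nat.not_even_iff_odd.1 hs').neg_one_pow] at h
  rw [← Int.cast_sum, sum_signedZigzagWords, if_neg hs']
  push_cast
  linarith

end DoublyAlternating

/-! ### The series L and (1 - t²)^(-1/2) through differential equations -/

namespace DoublyAlternating

open Finset PowerSeries

section ODE

variable {R : Type*} [CommRing R]

lemma derivative_one_sub_X : d⁄dX R (1 - X : R⟦X⟧) = -1 := by simp

lemma derivative_one_add_X : d⁄dX R (1 + X : R⟦X⟧) = 1 := by simp

lemma derivative_map {S : Type*} [CommRing S] (φ : R →+* S) (F : R⟦X⟧) :
    d⁄dX S (PowerSeries.map φ F) = PowerSeries.map φ (d⁄dX R F) := by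
  ext n
  simp [coeff_derivative]

/-- Solutions of `(1 - x²) F' = c F` are determined by their constant coefficient. -/
theorem eq_of_one_sub_sq_mul_derivative [IsDomain R] [CharZero R] {F H c : R⟦X⟧}
    (hF : (1 - X ^ 2) * d⁄dX R F = c * F) (hH : (1 - X ^ 2) * d⁄dX R H = c * H)
    (h0 : constantCoeff F = constantCoeff H) : F = H := by
  rw [← sub_eq_zero]
  set Z := F - H with hZ
  -- Comparing coefficients of degree `n` expresses `(n + 1)` times the coefficient of degree `n +
  -- 1` through lower ones.
  have hd : d⁄dX R Z = X ^ 2 * d⁄dX R Z + c * Z := by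
    rw [hZ, map_sub]
    linear_combination hF - hH
  ext n
  rw [map_zero]
  induction n using Nat.strong_induction_on with
  | _ n ih =>
  rcases n with _ | n
  · rw [coeff_zero_eq_constantCoeff_apply, hZ, map_sub, h0, sub_self]
  · have h := congrArg (coeff n) hd
    rw [map_add, coeff_X_pow_mul', coeff_mul, coeff_derivative,
      sum_eq_zero fun p hp => by
        rw [ih p.2 (by rw [HasAntidiagonal.mem_antidiagonal] at hp; omega), mul_zero], add_zero] at h
    have h' : coeff (n + 1) Z * ((n : R) + 1) = 0 := by
      rw [h]
      split_ifs with h2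
      · rw [coeff_derivative, ih _ (by omega), zero_mul]
      · rfl
    exact (mul_eq_zero.1 h').resolve_right (by exact_mod_cast Nat.succ_ne_zero n)

end ODE

/-- The series `F` is supported in the degrees congruent to `k` modulo `2`. -/
def HasParity {R : Type*} [CommRing R] (F : R⟦X⟧) (k : ℕ) : Prop :=
  ∀ n, Odd (n + k) → coeff n F = 0

lemma HasParity.mul {R : Type*} [CommRing R] {F G : R⟦X⟧} {k l : ℕ} (hF : HasParity F k)
    (hG : HasParity G l) : HasParity (F * G) (k + l) := by
  intro n hn
  rw [coeff_mul]
  refine sum_eq_zero fun p hp => ?_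
  rw [HasAntidiagonal.mem_antidiagonal] at hp
  by_cases h : Odd (p.1 + k)
  · rw [hF _ h, zero_mul]
  · rw [hG, mul_zero]
    rw [Nat.odd_iff] at *
    omega

lemma hasParity_one {R : Type*} [CommRing R] : HasParity (1 : R⟦X⟧) 0 := by
  intro n hn
  rw [coeff_one, if_neg]
  rintro rfl
  simp at hn

lemma HasParity.pow {R : Type*} [CommRing R] {F : R⟦X⟧} (hF : HasParity F 1) (r : ℕ) :
    HasParity (F ^ r) r := by
  induction r with
  | zero => exact hasParity_one
  | succ r ih => rw [pow_succ]; exact ih.mul hF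

lemma HasParity.map {R S : Type*} [CommRing R] [CommRing S] (φ : R →+* S) {F : R⟦X⟧} {k : ℕ}
    (hF : HasParity F k) : HasParity (PowerSeries.map φ F) k := by
  intro n hn
  rw [coeff_map, hF n hn, map_zero]

/-- The series `L` satisfies `(1 - t²) L' = 1`. -/
lemma one_sub_sq_mul_derivative_L : (1 - X ^ 2) * d⁄dX ℚ L = 1 := by
  set u : ℚ⟦X⟧ := (1 + X) * (1 - X)⁻¹ with hu
  have hu1 : u * (1 - X) = 1 + X := by
    rw [hu, mul_assoc, PowerSeries.inv_mul_cancel _ (by simp), mul_one]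
  have hu0 : constantCoeff (u - 1) = 0 := by simp [hu]
  have hs : HasSubst (u - 1) := HasSubst.of_constantCoeff_zero' hu0
  have hlog : d⁄dX ℚ (PowerSeries.log ℚ) * (1 + X) = 1 := by
    rw [deriv_log]
    ext n
    rcases n with _ | n
    · simp
    · simp [mul_add, coeff_succ_mul_X, coeff_one, pow_succ]
  have hsub : (d⁄dX ℚ (PowerSeries.log ℚ)).subst (u - 1) * u = 1 := by
    have h := congrArg (substAlgHom (R := ℚ) hs) hlog
    rw [map_mul, map_add, map_one, substAlgHom_X, add_sub_cancel, coe_substAlgHom] at h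
    exact h
  have hD : d⁄dX ℚ (logOf u) * u = d⁄dX ℚ u := by
    rw [logOf_eq, derivative_subst hs, map_sub, derivative_one, sub_zero, mul_right_comm, hsub,
      one_mul]
  have hu' : d⁄dX ℚ u * (1 - X) = 1 + u := by
    have h := congrArg (d⁄dX ℚ) hu1
    rw [Derivation.leibniz, derivative_one_sub_X, derivative_one_add_X, smul_eq_mul,
      smul_eq_mul] at h
    linear_combination h
  have h2 : d⁄dX ℚ (logOf u) * (1 + X) * (1 - X) = 2 := by
    rw [← hu1]
    linear_combination (1 - X) ^ 2 * hD + (1 - X) * hu' + hu1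
  have hL : L = (1 / 2 : ℚ) • logOf u := rfl
  rw [hL, Derivation.map_smul, mul_smul_comm,
    show (1 - X ^ 2) * d⁄dX ℚ (logOf u) = 2 by rw [← h2]; ring,
    show (2 : ℚ⟦X⟧) = (2 : ℚ) • 1 by rw [two_smul, one_add_one_eq_two], smul_smul]
  norm_num

lemma constantCoeff_L : constantCoeff L = 0 := by
  have : constantCoeff (logOf ((1 + X : ℚ⟦X⟧) * (1 - X)⁻¹)) = 0 :=
    constantCoeff_logOf (by simp)
  rw [L, PowerSeries.smul_eq_C_mul, map_mul, this, mul_zero]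

/-- `L(t) = t + t³/3 + t⁵/5 + ⋯`. -/
theorem L_eq : L = PowerSeries.mk fun n : ℕ => if Odd n then (1 / n : ℚ) else 0 := by
  set M : ℚ⟦X⟧ := PowerSeries.mk fun n : ℕ => if Odd n then (1 / n : ℚ) else 0 with hM
  have hM' : d⁄dX ℚ M = PowerSeries.mk fun n => if Even n then 1 else 0 := by
    ext n
    rw [coeff_derivative, hM, coeff_mk, coeff_mk]
    rcases Nat.even_or_odd n with h | h
    · rw [if_pos h.add_one, if_pos h]
      push_cast
      field_simp
    · rw [if_neg (by simpa using h.add_one), if_neg (by simpa using h), zero_mul]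
  have hD : (1 - X ^ 2) * d⁄dX ℚ M = 1 := by
    ext n
    rw [hM', sub_mul, one_mul, map_sub, coeff_X_pow_mul', coeff_mk, coeff_one]
    rcases n with _ | _ | n
    · simp
    · simp
    · simp [Nat.even_add]
  have hne : (1 - X ^ 2 : ℚ⟦X⟧) ≠ 0 := fun h => by
    simpa using congrArg constantCoeff h
  apply PowerSeries.derivative.ext
  · apply mul_left_cancel₀ hne
    rw [hD, one_sub_sq_mul_derivative_L]
  · rw [constantCoeff_L, hM, ← coeff_zero_eq_constantCoeff_apply, coeff_mk]
    simp

lemma hasParity_L : HasParity L 1 := by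
  intro n hn
  rw [L_eq, coeff_mk, if_neg]
  rw [Nat.odd_iff] at *
  omega

lemma coeff_L_pow_of_lt {n r : ℕ} (h : n < r) : coeff n (L ^ r) = 0 := by
  have : X ∣ L := by rw [X_dvd_iff, constantCoeff_L]
  exact X_pow_dvd_iff.1 (pow_dvd_pow_of_dvd this r) n h

/-- `(1 - t²) Q² = 1` for `Q = (1 - t²)^(-1/2)`. -/
lemma one_sub_sq_mul_invSqrt_sq : (1 - X ^ 2) * (invSqrtOneSubSq * invSqrtOneSubSq) = 1 := by
  have hs : HasSubst (-X ^ 2 : ℚ⟦X⟧) := HasSubst.of_constantCoeff_zero' (by simp)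
  have h : (1 + X) * (PowerSeries.binomialSeries ℚ (-1 / 2 : ℚ) *
      PowerSeries.binomialSeries ℚ (-1 / 2 : ℚ)) = 1 := by
    have e : (1 + X : ℚ⟦X⟧) = PowerSeries.binomialSeries ℚ (1 : ℚ) := by
      have := binomialSeries_nat (R := ℚ) (A := ℚ) 1
      rw [pow_one, Nat.cast_one] at this
      exact this.symm
    rw [e, ← binomialSeries_add, ← binomialSeries_add]
    norm_num
  have h' := congrArg (substAlgHom (R := ℚ) hs) h
  rw [map_mul, map_mul, map_add, map_one, substAlgHom_X, coe_substAlgHom] at h'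
  rw [sub_eq_add_neg]
  exact h'

lemma constantCoeff_invSqrt : constantCoeff invSqrtOneSubSq = 1 := by
  have hs : HasSubst (-X ^ 2 : ℚ⟦X⟧) := HasSubst.of_constantCoeff_zero' (by simp)
  rw [invSqrtOneSubSq, ← coeff_zero_eq_constantCoeff_apply, coeff_subst' hs, finsum_eq_single _ 0]
  · simp
  · intro d hd
    simp [hd]

lemma hasParity_invSqrt : HasParity invSqrtOneSubSq 0 := by
  have hs : HasSubst (-X ^ 2 : ℚ⟦X⟧) := HasSubst.of_constantCoeff_zero' (by simp)
  intro n hn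
  rw [invSqrtOneSubSq, coeff_subst' hs]
  apply finsum_eq_zero_of_forall_eq_zero
  intro d
  rw [neg_pow, ← pow_mul, show ((-1 : ℚ⟦X⟧) ^ d) = C ((-1 : ℚ) ^ d) by simp, coeff_C_mul,
    coeff_X_pow, if_neg, mul_zero, smul_zero]
  rintro rfl
  rw [Nat.odd_iff] at hn
  omega

/-- Differentiate `(1 - t²) Q² = 1` and cancel `2 Q`. -/
lemma one_sub_sq_mul_derivative_invSqrt :
    (1 - X ^ 2) * d⁄dX ℚ invSqrtOneSubSq = X * invSqrtOneSubSq := by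
  set Q := invSqrtOneSubSq with hQ
  have hne : (2 * Q : ℚ⟦X⟧) ≠ 0 := fun h => by
    have h0 := congrArg constantCoeff h
    rw [map_mul, hQ, constantCoeff_invSqrt, map_ofNat, map_zero] at h0
    norm_num at h0
  have h := congrArg (d⁄dX ℚ) one_sub_sq_mul_invSqrt_sq
  simp only [Derivation.leibniz, map_sub, derivative_one, derivative_pow, derivative_X,
    smul_eq_mul, ← hQ] at h
  apply mul_left_cancel₀ hne
  push_cast at h
  linear_combination h

end DoublyAlternating

/-! ### The series exp(y L(t)) over ℚ[y] and the shifts y ↦ y ± 1 -/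

namespace DoublyAlternating

open Finset PowerSeries
open scoped Polynomial

section General

variable {R : Type*} [CommRing R]

lemma derivative_mul (F G : R⟦X⟧) : d⁄dX R (F * G) = F * d⁄dX R G + G * d⁄dX R F := by
  rw [Derivation.leibniz, smul_eq_mul, smul_eq_mul]

lemma constantCoeff_map_apply {S : Type*} [CommRing S] (φ : R →+* S) (F : R⟦X⟧) :
    constantCoeff (PowerSeries.map φ F) = φ (constantCoeff F) := by
  rw [← coeff_zero_eq_constantCoeff_apply, coeff_map, coeff_zero_eq_constantCoeff_apply]

/-- Substitution of `a` into series with coefficients mapped along `φ`. -/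
noncomputable def mapSubst {S : Type*} [CommRing S] (φ : R →+* S) {a : S⟦X⟧} (ha : HasSubst a) :
    R⟦X⟧ →+* S⟦X⟧ :=
  (substAlgHom (R := S) ha).toRingHom.comp (PowerSeries.map φ)

lemma mapSubst_apply {S : Type*} [CommRing S] (φ : R →+* S) {a : S⟦X⟧} (ha : HasSubst a)
    (A : R⟦X⟧) : mapSubst φ ha A = (PowerSeries.map φ A).subst a := by
  rw [← coe_substAlgHom ha]
  rfl

lemma coeff_mapSubst {S : Type*} [CommRing S] (φ : R →+* S) {a : S⟦X⟧} (ha : HasSubst a)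
    (A : R⟦X⟧) (n : ℕ) :
    coeff n (mapSubst φ ha A) = ∑ᶠ r, φ (coeff r A) * coeff n (a ^ r) := by
  rw [mapSubst_apply, coeff_subst' ha]
  simp only [coeff_map, smul_eq_mul]

lemma derivative_mapSubst {S : Type*} [CommRing S] (φ : R →+* S) {a : S⟦X⟧} (ha : HasSubst a)
    (A : R⟦X⟧) : d⁄dX S (mapSubst φ ha A) = mapSubst φ ha (d⁄dX R A) * d⁄dX S a := by
  rw [mapSubst_apply, mapSubst_apply, derivative_subst ha, derivative_map]

end General

/-- The series `y L(t)` with coefficients in `ℚ[y]`. -/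
noncomputable def argL : ℚ[X]⟦X⟧ := C Polynomial.X * PowerSeries.map Polynomial.C L

lemma hasSubst_argL : HasSubst argL :=
  HasSubst.of_constantCoeff_zero' (by
    rw [argL, map_mul, constantCoeff_map_apply, constantCoeff_L, map_zero, mul_zero])

/-- The substitution `A ↦ A(y L(t))`. -/
noncomputable def substL : ℚ⟦X⟧ →+* ℚ[X]⟦X⟧ :=
  mapSubst Polynomial.C hasSubst_argL

lemma coeff_substL (A : ℚ⟦X⟧) (n : ℕ) :
    coeff n (substL A) = ∑ r ∈ range (n + 1),
      Polynomial.C (coeff r A * coeff n (L ^ r)) * Polynomial.X ^ r := by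
  have h : ∀ r, coeff n (argL ^ r) = Polynomial.C (coeff n (L ^ r)) * Polynomial.X ^ r := by
    intro r
    rw [argL, mul_pow, ← map_pow, ← map_pow, coeff_C_mul, coeff_map, mul_comm]
  rw [substL, coeff_mapSubst, finsum_eq_sum_of_support_subset (s := range (n + 1))]
  · refine sum_congr rfl fun r _ => ?_
    rw [h, map_mul, mul_assoc]
  · intro r hr
    rw [Function.mem_support] at hr
    by_contra hn
    apply hr
    rw [h, coeff_L_pow_of_lt (by simpa using hn), map_zero, zero_mul, mul_zero]

lemma HasParity.substL {A : ℚ⟦X⟧} {k : ℕ} (hA : HasParity A k) : HasParity (substL A) k := by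
  intro n hn
  rw [coeff_substL]
  refine sum_eq_zero fun r _ => ?_
  by_cases hr : Odd (r + k)
  · rw [hA r hr, zero_mul, map_zero, zero_mul]
  · rw [hasParity_L.pow r n, mul_zero, map_zero, zero_mul]
    rw [Nat.odd_iff] at *
    omega

lemma map_one_sub_sq {R S : Type*} [CommRing R] [CommRing S] (φ : R →+* S) :
    PowerSeries.map φ (1 - X ^ 2) = 1 - X ^ 2 := by simp

/-- The series `exp (y L(t))`. -/
noncomputable def expL : ℚ[X]⟦X⟧ := substL (exp ℚ)

lemma constantCoeff_expL : constantCoeff expL = 1 := by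
  rw [← coeff_zero_eq_constantCoeff_apply, expL, coeff_substL]
  simp

lemma one_sub_sq_mul_derivative_expL :
    (1 - X ^ 2) * d⁄dX ℚ[X] expL = C Polynomial.X * expL := by
  have h1 : d⁄dX ℚ[X] argL = C Polynomial.X * PowerSeries.map Polynomial.C (d⁄dX ℚ L) := by
    rw [argL, derivative_mul, derivative_C, derivative_map, mul_zero, add_zero]
  have h2 := congrArg (PowerSeries.map (Polynomial.C (R := ℚ))) one_sub_sq_mul_derivative_L
  rw [map_mul, map_one_sub_sq, map_one] at h2
  have h3 : d⁄dX ℚ[X] expL = expL * d⁄dX ℚ[X] argL := by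
    rw [expL, substL, derivative_mapSubst, derivative_exp]
  rw [h3, h1]
  linear_combination C Polynomial.X * expL * h2

/-- The series `(1 - t²)^(-1/2)` with coefficients in `ℚ[y]`. -/
noncomputable def invSqrtPoly : ℚ[X]⟦X⟧ := PowerSeries.map Polynomial.C invSqrtOneSubSq

lemma one_sub_sq_mul_invSqrtPoly_sq : (1 - X ^ 2) * (invSqrtPoly * invSqrtPoly) = 1 := by
  have h := congrArg (PowerSeries.map (Polynomial.C (R := ℚ))) one_sub_sq_mul_invSqrt_sq
  rwa [map_mul, map_mul, map_one_sub_sq, map_one] at h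

lemma one_sub_sq_mul_derivative_invSqrtPoly :
    (1 - X ^ 2) * d⁄dX ℚ[X] invSqrtPoly = X * invSqrtPoly := by
  have h := congrArg (PowerSeries.map (Polynomial.C (R := ℚ))) one_sub_sq_mul_derivative_invSqrt
  rwa [map_mul, map_mul, map_one_sub_sq, map_X, ← derivative_map] at h

lemma constantCoeff_invSqrtPoly : constantCoeff invSqrtPoly = 1 := by
  rw [invSqrtPoly, constantCoeff_map_apply, constantCoeff_invSqrt, map_one]

/-- The series `(1 - t²)^(1/2) exp (y L(t))`. -/
noncomputable def sqrtExpL : ℚ[X]⟦X⟧ := (1 - X ^ 2) * invSqrtPoly * expL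

/-- The series `(1 - t²)^(-1/2) exp (y L(t))`. -/
noncomputable def invSqrtExpL : ℚ[X]⟦X⟧ := invSqrtPoly * expL

lemma derivative_one_sub_sq : d⁄dX ℚ[X] (1 - X ^ 2 : ℚ[X]⟦X⟧) = - (2 * X) := by
  simp

lemma one_sub_sq_mul_derivative_sqrtExpL :
    (1 - X ^ 2) * d⁄dX ℚ[X] sqrtExpL = (C Polynomial.X - X) * sqrtExpL := by
  rw [sqrtExpL, derivative_mul, derivative_mul, derivative_one_sub_sq]
  linear_combination (1 - X ^ 2) * invSqrtPoly * one_sub_sq_mul_derivative_expL +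
    (1 - X ^ 2) * expL * one_sub_sq_mul_derivative_invSqrtPoly

lemma one_sub_sq_mul_derivative_invSqrtExpL :
    (1 - X ^ 2) * d⁄dX ℚ[X] invSqrtExpL = (C Polynomial.X + X) * invSqrtExpL := by
  rw [invSqrtExpL, derivative_mul]
  linear_combination invSqrtPoly * one_sub_sq_mul_derivative_expL +
    expL * one_sub_sq_mul_derivative_invSqrtPoly

lemma constantCoeff_sqrtExpL : constantCoeff sqrtExpL = 1 := by
  simp [sqrtExpL, constantCoeff_invSqrtPoly, constantCoeff_expL]

lemma constantCoeff_invSqrtExpL : constantCoeff invSqrtExpL = 1 := by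
  simp [invSqrtExpL, constantCoeff_invSqrtPoly, constantCoeff_expL]

lemma constantCoeff_map_eq_one {R S : Type*} [CommRing R] [CommRing S] (φ : R →+* S) {F : R⟦X⟧}
    (h : constantCoeff F = 1) : constantCoeff (PowerSeries.map φ F) = 1 := by
  rw [constantCoeff_map_apply, h, map_one]

lemma one_sub_sq_mul_derivative_map {R S : Type*} [CommRing R] [CommRing S] (φ : R →+* S)
    {F c : R⟦X⟧} (h : (1 - X ^ 2) * d⁄dX R F = c * F) :
    (1 - X ^ 2) * d⁄dX S (PowerSeries.map φ F) = PowerSeries.map φ c * PowerSeries.map φ F := by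
  rw [derivative_map, ← map_one_sub_sq φ, ← map_mul, h, map_mul]

/-- If `H' (1 - t²) = c H`, then `(1 - t) H` satisfies the equation with `c - 1 - t`. -/
lemma one_sub_sq_mul_derivative_one_sub_mul {R : Type*} [CommRing R] {H c : R⟦X⟧}
    (h : (1 - X ^ 2) * d⁄dX R H = c * H) :
    (1 - X ^ 2) * d⁄dX R ((1 - X) * H) = (c - 1 - X) * ((1 - X) * H) := by
  rw [Derivation.leibniz, derivative_one_sub_X]
  simp only [smul_eq_mul]
  linear_combination (1 - X) * h

lemma one_sub_sq_mul_derivative_one_add_mul {R : Type*} [CommRing R] {H c : R⟦X⟧}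
    (h : (1 - X ^ 2) * d⁄dX R H = c * H) :
    (1 - X ^ 2) * d⁄dX R ((1 + X) * H) = (c + 1 - X) * ((1 + X) * H) := by
  rw [Derivation.leibniz, derivative_one_add_X]
  simp only [smul_eq_mul]
  linear_combination (1 + X) * h

/-- The shift `y ↦ P(y)` of the coefficients. -/
noncomputable def shift (P : ℚ[X]) : ℚ[X]⟦X⟧ →+* ℚ[X]⟦X⟧ :=
  PowerSeries.map (Polynomial.compRingHom P)

lemma coeff_shift (P : ℚ[X]) (F : ℚ[X]⟦X⟧) (n : ℕ) :
    coeff n (shift P F) = (coeff n F).comp P := by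
  rw [shift, coeff_map, Polynomial.coe_compRingHom_apply]

lemma shift_C_X (P : ℚ[X]) : shift P (C Polynomial.X) = C P := by
  rw [shift, map_C, Polynomial.coe_compRingHom_apply, Polynomial.X_comp]

lemma shift_X (P : ℚ[X]) : shift P X = X := by rw [shift, map_X]

/-- The shift multiplies by exp L = √((1 + t)/(1 - t)), and (1 - t) exp L = √(1 - t²). The square
root is avoided by comparing differential equations and constant terms. -/
lemma one_sub_X_mul_shift_expL : (1 - X) * shift (Polynomial.X + 1) expL = sqrtExpL := by
  refine eq_of_one_sub_sq_mul_derivative (c := C Polynomial.X - X) ?_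
    one_sub_sq_mul_derivative_sqrtExpL ?_
  · have h := one_sub_sq_mul_derivative_one_sub_mul (one_sub_sq_mul_derivative_map
      (Polynomial.compRingHom (Polynomial.X + 1)) one_sub_sq_mul_derivative_expL)
    change _ = (shift _ _ - 1 - X) * _ at h
    rw [shift_C_X, map_add, map_one, add_sub_cancel_right] at h
    exact h
  · rw [map_mul, shift, constantCoeff_map_eq_one _ constantCoeff_expL, constantCoeff_sqrtExpL]
    simp

lemma one_add_X_mul_shift_expL : (1 + X) * shift (Polynomial.X - 1) expL = sqrtExpL := by
  refine eq_of_one_sub_sq_mul_derivative (c := C Polynomial.X - X) ?_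
    one_sub_sq_mul_derivative_sqrtExpL ?_
  · have h := one_sub_sq_mul_derivative_one_add_mul (one_sub_sq_mul_derivative_map
      (Polynomial.compRingHom (Polynomial.X - 1)) one_sub_sq_mul_derivative_expL)
    change _ = (shift _ _ + 1 - X) * _ at h
    rw [shift_C_X, map_sub, map_one, sub_add_cancel] at h
    exact h
  · rw [map_mul, shift, constantCoeff_map_eq_one _ constantCoeff_expL, constantCoeff_sqrtExpL]
    simp

lemma one_sub_X_mul_shift_invSqrtExpL :
    (1 - X) * shift (Polynomial.X + 1) invSqrtExpL = expL := by
  refine eq_of_one_sub_sq_mul_derivative (c := C Polynomial.X) ?_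
    one_sub_sq_mul_derivative_expL ?_
  · have h := one_sub_sq_mul_derivative_one_sub_mul (one_sub_sq_mul_derivative_map
      (Polynomial.compRingHom (Polynomial.X + 1)) one_sub_sq_mul_derivative_invSqrtExpL)
    change _ = (shift _ _ - 1 - X) * _ at h
    rw [map_add, shift_C_X, shift_X, map_add, map_one,
      show C Polynomial.X + 1 + X - 1 - X = (C Polynomial.X : ℚ[X]⟦X⟧) by ring] at h
    exact h
  · rw [map_mul, shift, constantCoeff_map_eq_one _ constantCoeff_invSqrtExpL, constantCoeff_expL]
    simp

lemma one_add_X_mul_shift_invSqrtExpL :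
    (1 + X) * shift (Polynomial.X - 1) invSqrtExpL = expL := by
  refine eq_of_one_sub_sq_mul_derivative (c := C Polynomial.X) ?_
    one_sub_sq_mul_derivative_expL ?_
  · have h := one_sub_sq_mul_derivative_one_add_mul (one_sub_sq_mul_derivative_map
      (Polynomial.compRingHom (Polynomial.X - 1)) one_sub_sq_mul_derivative_invSqrtExpL)
    change _ = (shift _ _ + 1 - X) * _ at h
    rw [map_add, shift_C_X, shift_X, map_sub, map_one,
      show C Polynomial.X - 1 + X + 1 - X = (C Polynomial.X : ℚ[X]⟦X⟧) by ring] at h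
    exact h
  · rw [map_mul, shift, constantCoeff_map_eq_one _ constantCoeff_invSqrtExpL, constantCoeff_expL]
    simp

/-- The alternating geometric series. -/
lemma mk_neg_one_pow_mul_one_add {R : Type*} [CommRing R] :
    (PowerSeries.mk fun n => (-1 : R) ^ n) * (1 + X) = 1 := by
  ext n
  rcases n with _ | n
  · simp
  · simp [mul_add, coeff_succ_mul_X, coeff_one, pow_succ]

lemma sum_coeff_of_one_sub_X_mul {R : Type*} [CommRing R] {F G : R⟦X⟧} (h : (1 - X) * F = G)
    (m : ℕ) : ∑ j ∈ range (m + 1), coeff (m - j) G = coeff m F := by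
  have : F = PowerSeries.mk 1 * G := by
    rw [← h, ← mul_assoc, mk_one_mul_one_sub_eq_one, one_mul]
  rw [this, coeff_mul, Finset.Nat.sum_antidiagonal_eq_sum_range_succ_mk]
  simp

lemma sum_coeff_of_one_add_X_mul {R : Type*} [CommRing R] {F G : R⟦X⟧} (h : (1 + X) * F = G)
    (m : ℕ) : ∑ j ∈ range (m + 1), (-1) ^ j * coeff (m - j) G = coeff m F := by
  have : F = (PowerSeries.mk fun n => (-1 : R) ^ n) * G := by
    rw [← h, ← mul_assoc, mk_neg_one_pow_mul_one_add, one_mul]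
  rw [this, coeff_mul, Finset.Nat.sum_antidiagonal_eq_sum_range_succ_mk]
  simp

lemma eval_zero_coeff_expL (m : ℕ) : (coeff m expL).eval 0 = if m = 0 then 1 else 0 := by
  have h : PowerSeries.map (Polynomial.evalRingHom 0) expL = 1 := by
    refine eq_of_one_sub_sq_mul_derivative (c := 0) ?_ (by simp) ?_
    · have := one_sub_sq_mul_derivative_map (Polynomial.evalRingHom 0)
        one_sub_sq_mul_derivative_expL
      rwa [map_C, Polynomial.coe_evalRingHom, Polynomial.eval_X, map_zero] at this
    · rw [constantCoeff_map_eq_one _ constantCoeff_expL, map_one]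
  have := congrArg (coeff m) h
  rwa [coeff_map, Polynomial.coe_evalRingHom, coeff_one] at this

/-- At y = 1 the series is (1 - t²)^(-1/2) exp L = 1/(1 - t). -/
lemma eval_one_coeff_invSqrtExpL (m : ℕ) : (coeff m invSqrtExpL).eval 1 = 1 := by
  have h : (1 - X) * PowerSeries.map (Polynomial.evalRingHom 1) invSqrtExpL = 1 := by
    refine eq_of_one_sub_sq_mul_derivative (c := 0) ?_ (by simp) ?_
    · have := one_sub_sq_mul_derivative_one_sub_mul (one_sub_sq_mul_derivative_map
        (Polynomial.evalRingHom 1) one_sub_sq_mul_derivative_invSqrtExpL)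
      rwa [map_add, map_C, Polynomial.coe_evalRingHom, Polynomial.eval_X, map_X, map_one,
        show (1 + X - 1 - X : ℚ⟦X⟧) = 0 by ring] at this
    · rw [map_mul, constantCoeff_map_eq_one _ constantCoeff_invSqrtExpL]
      simp
  have := sum_coeff_of_one_sub_X_mul h m
  rw [coeff_map, Polynomial.coe_evalRingHom] at this
  rw [← this, sum_eq_single m]
  · simp
  · intro j hj hjm
    rw [mem_range] at hj
    rw [coeff_one, if_neg (by omega)]
  · simp

lemma eval_neg_one_coeff_invSqrtExpL (m : ℕ) :
    (coeff m invSqrtExpL).eval (-1) = (-1) ^ m := by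
  have h : (1 + X) * PowerSeries.map (Polynomial.evalRingHom (-1)) invSqrtExpL = 1 := by
    refine eq_of_one_sub_sq_mul_derivative (c := 0) ?_ (by simp) ?_
    · have := one_sub_sq_mul_derivative_one_add_mul (one_sub_sq_mul_derivative_map
        (Polynomial.evalRingHom (-1)) one_sub_sq_mul_derivative_invSqrtExpL)
      rwa [map_add, map_C, Polynomial.coe_evalRingHom, Polynomial.eval_X, map_X, map_neg, map_one,
        show (-1 + X + 1 - X : ℚ⟦X⟧) = 0 by ring] at this
    · rw [map_mul, constantCoeff_map_eq_one _ constantCoeff_invSqrtExpL]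
      simp
  have := sum_coeff_of_one_add_X_mul h m
  rw [coeff_map, Polynomial.coe_evalRingHom] at this
  rw [← this, sum_eq_single m]
  · simp
  · intro j hj hjm
    rw [mem_range] at hj
    rw [coeff_one, if_neg (by omega), mul_zero]
  · simp

/-- Zigzag words of even length in terms of the coefficients of `(1 - t²)^(1/2) exp (y L(t))`. -/
theorem signedZigzagWords_eq_of_even {s : Multiset ℕ} (hs : Even (Multiset.card s)) :
    (signedZigzagWords s : ℚ) =
      momentFunctional sechMoment (weight (fun m => coeff m sqrtExpL) s) := by
  refine signedZigzagWords_of_even (e := fun m => coeff m expL) ?_ (fun m => ?_) (fun m => ?_)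
    eval_zero_coeff_expL hs
  · rw [coeff_zero_eq_constantCoeff_apply, constantCoeff_sqrtExpL]
  · rw [sum_coeff_of_one_sub_X_mul one_sub_X_mul_shift_expL, coeff_shift]
  · rw [sum_coeff_of_one_add_X_mul one_add_X_mul_shift_expL, coeff_shift]

/-- Zigzag words of odd length in terms of the coefficients of `exp (y L(t))`. -/
theorem signedZigzagWords_eq_of_odd {s : Multiset ℕ} (hs : ¬ Even (Multiset.card s)) :
    (signedZigzagWords s : ℚ) =
      momentFunctional tanhMoment (weight (fun m => coeff m expL) s) := by
  refine signedZigzagWords_of_odd (e := fun m => coeff m invSqrtExpL) ?_ (fun m => ?_)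
    (fun m => ?_) eval_one_coeff_invSqrtExpL eval_neg_one_coeff_invSqrtExpL hs
  · rw [coeff_zero_eq_constantCoeff_apply, constantCoeff_expL]
  · rw [sum_coeff_of_one_sub_X_mul one_sub_X_mul_shift_invSqrtExpL, coeff_shift]
  · rw [sum_coeff_of_one_add_X_mul one_add_X_mul_shift_invSqrtExpL, coeff_shift]

end DoublyAlternating

/-! ### Hyperbolic series and the quotient of odd and even parts -/

namespace DoublyAlternating

open Finset PowerSeries
open scoped Polynomial

/-- The hyperbolic cosine series. -/
noncomputable def coshSeries : ℚ⟦X⟧ :=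
  PowerSeries.mk fun n => if Even n then 1 / (n.factorial : ℚ) else 0

/-- The hyperbolic sine series. -/
noncomputable def sinhSeries : ℚ⟦X⟧ :=
  PowerSeries.mk fun n => if Even n then 0 else 1 / (n.factorial : ℚ)

/-- The hyperbolic secant series. -/
noncomputable def sechSeries : ℚ⟦X⟧ :=
  PowerSeries.mk fun n => sechMoment n / (n.factorial : ℚ)

/-- The hyperbolic tangent series. -/
noncomputable def tanhSeries : ℚ⟦X⟧ :=
  PowerSeries.mk fun n => tanhMoment n / (n.factorial : ℚ)

lemma coeff_cosh_mul (a : ℕ → ℚ) (n : ℕ) :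
    coeff n (coshSeries * PowerSeries.mk fun n => a n / (n.factorial : ℚ)) =
      (∑ j ∈ range (n + 1), (n.choose j : ℚ) * (if Even j then a (n - j) else 0)) /
        (n.factorial : ℚ) := by
  rw [coeff_mul, Finset.Nat.sum_antidiagonal_eq_sum_range_succ_mk, sum_div]
  refine sum_congr rfl fun j hj => ?_
  rw [mem_range] at hj
  rw [coshSeries, coeff_mk, coeff_mk, Nat.cast_choose ℚ (by omega : j ≤ n)]
  have h1 : (j.factorial : ℚ) ≠ 0 := by exact_mod_cast j.factorial_ne_zero
  have h2 : ((n - j).factorial : ℚ) ≠ 0 := by exact_mod_cast (n - j).factorial_ne_zero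
  have h3 : (n.factorial : ℚ) ≠ 0 := by exact_mod_cast n.factorial_ne_zero
  split_ifs
  · field_simp
  · simp

lemma cosh_mul_sech : coshSeries * sechSeries = 1 := by
  ext n
  rw [sechSeries, coeff_cosh_mul, sum_choose_sechMoment, coeff_one]
  split_ifs with h
  · simp [h]
  · simp

lemma cosh_mul_tanh : coshSeries * tanhSeries = sinhSeries := by
  ext n
  rw [tanhSeries, coeff_cosh_mul, sum_choose_tanhMoment, sinhSeries, coeff_mk]
  split_ifs <;> simp

lemma cosh_add_sinh : coshSeries + sinhSeries = exp ℚ := by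
  ext n
  rw [map_add, coshSeries, sinhSeries, coeff_mk, coeff_mk, coeff_exp]
  split_ifs <;> simp

lemma cosh_sub_sinh : coshSeries - sinhSeries = evalNegHom (exp ℚ) := by
  ext n
  rw [map_sub, coshSeries, sinhSeries, coeff_mk, coeff_mk, evalNegHom, coeff_rescale, coeff_exp]
  rcases Nat.even_or_odd n with h | h
  · simp [h, h.neg_one_pow]
  · have : ¬ Even n := by simpa using h
    simp [this, h.neg_one_pow]

/-- After multiplication by cosh this is cosh² - sinh² = 1. -/
lemma cosh_sub_sinh_mul_tanh : coshSeries - sinhSeries * tanhSeries = sechSeries := by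
  have h : (coshSeries + sinhSeries) * (coshSeries - sinhSeries) = 1 := by
    rw [cosh_add_sinh, cosh_sub_sinh, exp_mul_exp_neg_eq_one]
  have hne : coshSeries ≠ 0 := fun h => by simpa [h] using cosh_mul_sech
  apply mul_left_cancel₀ hne
  linear_combination h - cosh_mul_sech - sinhSeries * cosh_mul_tanh

lemma hasParity_cosh : HasParity coshSeries 0 := fun n hn => by
  have : ¬ Even n := by simpa using hn
  rw [coshSeries, coeff_mk, if_neg this]

lemma hasParity_sinh : HasParity sinhSeries 1 := fun n hn => by
  have : Even n := by rw [Nat.odd_iff] at hn; rw [Nat.even_iff]; omega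
  rw [sinhSeries, coeff_mk, if_pos this]

lemma hasParity_sech : HasParity sechSeries 0 := fun n hn => by
  have : ¬ Even n := by simpa using hn
  rw [sechSeries, coeff_mk, sechMoment, if_neg this, zero_div]

lemma hasParity_tanh : HasParity tanhSeries 1 := fun n hn => by
  have : Even n := by rw [Nat.odd_iff] at hn; rw [Nat.even_iff]; omega
  rw [tanhSeries, coeff_mk, tanhMoment, if_pos this, zero_div]

lemma sum_range_eq_sum_even {M : Type*} [AddCommMonoid M] (F : ℕ → M) (m : ℕ)
    (hF : ∀ i, Odd i → F i = 0) :
    ∑ i ∈ range (m + 1), F i = ∑ j ∈ range (m / 2 + 1), F (2 * j) := by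
  rw [← sum_image (s := range (m / 2 + 1)) (g := fun j => 2 * j) (f := F)
    (fun a _ b _ h => by simpa using h)]
  symm
  apply sum_subset
  · intro i hi
    obtain ⟨j, hj, rfl⟩ := mem_image.1 hi
    rw [mem_range] at *
    omega
  · intro i hi hi'
    apply hF
    by_contra h
    rw [Nat.not_odd_iff_even] at h
    obtain ⟨j, rfl⟩ := h
    apply hi'
    rw [mem_range] at hi
    exact mem_image.2 ⟨j, mem_range.2 (by omega), by ring⟩

section Quotient

variable {U V : ℚ[X]⟦X⟧}

lemma coeff_mul_expL_of_even (hU : HasParity U 0) {m : ℕ} (hm : Even m) :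
    coeff m (U * expL) = coeff m (U * substL coshSeries) := by
  rw [expL, ← cosh_add_sinh, map_add, mul_add, map_add,
    hU.mul hasParity_sinh.substL m (by rw [Nat.odd_iff]; rw [Nat.even_iff] at hm; omega), add_zero]

lemma coeff_mul_expL_of_odd (hU : HasParity U 0) {m : ℕ} (hm : Odd m) :
    coeff m (U * expL) = coeff m (U * substL sinhSeries) := by
  rw [expL, ← cosh_add_sinh, map_add, mul_add, map_add,
    hU.mul hasParity_cosh.substL m (by simpa using hm), zero_add]

/-- The quotient of `1` plus the odd part of `U exp (y L)` by its even part. -/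
theorem sum_coeff_mul_quotient (hU : HasParity U 0) (hUV : U * V = 1) (m : ℕ) :
    ∑ j ∈ range (m / 2 + 1), coeff (2 * j) (U * expL) *
      coeff (m - 2 * j) (V * substL sechSeries + substL tanhSeries) =
      if Even m then (if m = 0 then 1 else 0) else coeff m (U * expL) := by
  -- `U` is even in t, so `U cosh(yL)` and `U sinh(yL)` are the even and odd parts of `U exp(yL)`.
  have h : U * substL coshSeries * (V * substL sechSeries + substL tanhSeries) =
      1 + U * substL sinhSeries := by
    have h1 := congrArg substL cosh_mul_sech
    have h2 := congrArg substL cosh_mul_tanh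
    rw [map_mul] at h1 h2
    rw [map_one] at h1
    linear_combination U * V * h1 + U * h2 + hUV
  have h' := congrArg (coeff m) h
  rw [coeff_mul, Finset.Nat.sum_antidiagonal_eq_sum_range_succ_mk, sum_range_eq_sum_even] at h'
  · simp only at h'
    rw [sum_congr rfl fun j _ => by rw [coeff_mul_expL_of_even hU (even_two_mul j)], h', map_add,
      coeff_one]
    by_cases hm : Even m
    · rw [if_pos hm, hU.mul hasParity_sinh.substL m
        (by rw [Nat.odd_iff]; rw [Nat.even_iff] at hm; omega), add_zero]
    · have : m ≠ 0 := by rintro rfl; simp at hm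
      rw [if_neg hm, if_neg this, zero_add, coeff_mul_expL_of_odd hU (by simpa using hm)]
  · intro i hi
    simp only
    rw [hU.mul hasParity_cosh.substL i (by simpa using hi), zero_mul]

/-- In even degree, the series `U cosh(yL) - U sinh(yL) tanh(yL)` is read off; `V sech(yL)` is even
and drops out of the odd coefficients of the quotient. -/
lemma coeff_sub_sum_eq (hU : HasParity U 0) (hV : HasParity V 0) (k : ℕ) :
    coeff (2 * k + 2) (U * expL) - ∑ j ∈ range (k + 1), coeff (2 * j + 1) (U * expL) *
      coeff (2 * k + 1 - 2 * j) (V * substL sechSeries + substL tanhSeries) =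
      coeff (2 * k + 2) (U * substL sechSeries) := by
  have h1 := congrArg substL cosh_sub_sinh_mul_tanh
  rw [map_sub, map_mul] at h1
  have h2 : U * substL sechSeries =
      U * substL coshSeries - U * substL sinhSeries * substL tanhSeries := by
    rw [← h1]
    ring
  rw [coeff_mul_expL_of_even hU (by simp [Nat.even_add]), h2, map_sub,
    coeff_mul _ (U * substL sinhSeries), Finset.Nat.sum_antidiagonal_eq_sum_range_succ_mk,
    sum_range_succ' _ (2 * k + 2)]
  simp only
  rw [hU.mul hasParity_sinh.substL 0 (by simp), zero_mul, add_zero,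
    sum_range_eq_sum_even _ (2 * k + 1), show (2 * k + 1) / 2 = k by omega]
  · congr 1
    refine sum_congr rfl fun j hj => ?_
    rw [mem_range] at hj
    rw [coeff_mul_expL_of_odd hU (by simp), map_add,
      hV.mul hasParity_sech.substL _ (by rw [Nat.odd_iff]; omega), zero_add,
      show 2 * k + 2 - (2 * j + 1) = 2 * k + 1 - 2 * j by omega]
  · intro i hi
    rw [hU.mul hasParity_sinh.substL _ (by rw [Nat.odd_iff] at *; omega), zero_mul]

end Quotient

/-! ### Applying the functionals, and the generating functions -/

/-- The formal sum `∑ d r L ^ r`. -/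
noncomputable def sumL (d : ℕ → ℚ) : ℚ⟦X⟧ :=
  PowerSeries.mk fun n => ∑ r ∈ range (n + 1), d r * coeff n (L ^ r)

theorem hasFormalSum_sumL (d : ℕ → ℚ) {i : ℕ → ℕ} (hi : Function.Injective i)
    (hd : ∀ r, r ∉ Set.range i → d r = 0) :
    HasFormalSum (fun r => d (i r) • L ^ i r) (sumL d) := by
  let _ : TopologicalSpace ℚ := ⊥
  let _ : TopologicalSpace ℚ⟦X⟧ := PowerSeries.WithPiTopology.instTopologicalSpace ℚ
  change HasSum (fun r => d (i r) • L ^ i r) (sumL d)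
  rw [PowerSeries.WithPiTopology.hasSum_iff_hasSum_coeff]
  intro n
  have h : HasSum (fun r => d r * coeff n (L ^ r)) (coeff n (sumL d)) := by
    rw [sumL, coeff_mk]
    refine hasSum_sum_of_ne_finset_zero fun r hr => ?_
    rw [coeff_L_pow_of_lt (by simpa using hr), mul_zero]
  rw [← hi.hasSum_iff] at h
  · simpa [Function.comp_def] using h
  · intro r hr
    rw [hd r hr, zero_mul]

/-- The functional replaces each `y ^ r` in `A(y L)` by `a r`. With `A` the series whose moments are
`a`, the coefficients get squared. -/
lemma momentFunctional_coeff (a : ℕ → ℚ) (W A : ℚ⟦X⟧) (n : ℕ) :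
    momentFunctional a (coeff n (PowerSeries.map Polynomial.C W * substL A)) =
      coeff n (W * sumL fun r => coeff r A * a r) := by
  rw [coeff_mul, coeff_mul, map_sum]
  refine sum_congr rfl fun p _ => ?_
  rw [coeff_map, ← Polynomial.smul_eq_C_mul, map_smul, smul_eq_mul, coeff_substL, map_sum, sumL,
    coeff_mk]
  congr 1
  refine sum_congr rfl fun r _ => ?_
  rw [momentFunctional_C_mul_X_pow]
  ring

/-- The coefficients of the generating function for even `n`. -/
noncomputable def sechWeight (r : ℕ) : ℚ := coeff r sechSeries * sechMoment r

/-- The coefficients of the generating function for odd `n`. -/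
noncomputable def tanhWeight (r : ℕ) : ℚ := coeff r tanhSeries * tanhMoment r

lemma sechWeight_two_mul (r : ℕ) :
    sechWeight (2 * r) = (eulerNumber (2 * r) : ℚ) ^ 2 / ((2 * r).factorial : ℚ) := by
  rw [sechWeight, sechSeries, coeff_mk, sechMoment, if_pos (even_two_mul r), div_mul_eq_mul_div,
    signedEuler_sq]

lemma tanhWeight_two_mul_add_one (r : ℕ) :
    tanhWeight (2 * r + 1) =
      (eulerNumber (2 * r + 1) : ℚ) ^ 2 / ((2 * r + 1).factorial : ℚ) := by
  rw [tanhWeight, tanhSeries, coeff_mk, tanhMoment, if_neg (by simp), div_mul_eq_mul_div,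
    signedEuler_sq]

lemma sechWeight_of_odd {r : ℕ} (hr : Odd r) : sechWeight r = 0 := by
  rw [sechWeight, hasParity_sech r (by simpa using hr), zero_mul]

lemma tanhWeight_of_even {r : ℕ} (hr : Even r) : tanhWeight r = 0 := by
  rw [tanhWeight, hasParity_tanh r hr.add_one, zero_mul]

lemma hasFormalSum_even :
    HasFormalSum (fun r => ((eulerNumber (2 * r) : ℚ) ^ 2 / ((2 * r).factorial : ℚ)) •
      L ^ (2 * r)) (sumL sechWeight) := by
  simp only [← sechWeight_two_mul]
  refine hasFormalSum_sumL sechWeight (i := fun r => 2 * r) (fun a b h => by simpa using h) ?_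
  intro r hr
  apply sechWeight_of_odd
  rw [← Nat.not_even_iff_odd]
  rintro ⟨k, rfl⟩
  exact hr ⟨k, by ring⟩

lemma hasFormalSum_odd :
    HasFormalSum (fun r => ((eulerNumber (2 * r + 1) : ℚ) ^ 2 / ((2 * r + 1).factorial : ℚ)) •
      L ^ (2 * r + 1)) (sumL tanhWeight) := by
  simp only [← tanhWeight_two_mul_add_one]
  refine hasFormalSum_sumL tanhWeight (i := fun r => 2 * r + 1) (fun a b h => by simpa using h) ?_
  intro r hr
  apply tanhWeight_of_even
  rw [← Nat.not_odd_iff_even]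
  rintro ⟨k, rfl⟩
  exact hr ⟨k, rfl⟩

lemma HasParity.sumL {d : ℕ → ℚ} {k : ℕ} (hd : ∀ r, Odd (r + k) → d r = 0) :
    HasParity (sumL d) k := by
  intro n hn
  rw [DoublyAlternating.sumL, coeff_mk]
  refine sum_eq_zero fun r _ => ?_
  by_cases hr : Odd (r + k)
  · rw [hd r hr, zero_mul]
  · rw [hasParity_L.pow r n, mul_zero]
    rw [Nat.odd_iff] at *
    omega

lemma hasParity_invSqrtPoly : HasParity invSqrtPoly 0 := hasParity_invSqrt.map _

lemma hasParity_sqrtPoly : HasParity ((1 - X ^ 2) * invSqrtPoly) 0 := by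
  refine HasParity.mul (k := 0) (l := 0) ?_ hasParity_invSqrtPoly
  intro n hn
  rw [map_sub, coeff_one, coeff_X_pow, if_neg, if_neg, sub_zero]
  · rintro rfl; exact absurd hn (by decide)
  · rintro rfl; exact absurd hn (by decide)

lemma sqrtPoly_mul_invSqrtPoly : (1 - X ^ 2) * invSqrtPoly * invSqrtPoly = 1 := by
  rw [mul_assoc, one_sub_sq_mul_invSqrtPoly_sq]

theorem f_eq_coeff_of_even {n : ℕ} (hn : Even n) :
    (f n : ℚ) = coeff n (invSqrtOneSubSq * sumL sechWeight) := by
  have h := f_eq_of_functional (n := n) (momentFunctional sechMoment)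
    (fun m => coeff m sqrtExpL)
    (fun m => coeff m (invSqrtPoly * substL sechSeries + substL tanhSeries))
    (by rw [coeff_zero_eq_constantCoeff_apply, constantCoeff_sqrtExpL])
    (fun s hs => signedZigzagWords_eq_of_even (hs ▸ hn))
    (sum_coeff_mul_quotient hasParity_sqrtPoly sqrtPoly_mul_invSqrtPoly)
  rw [h, map_add, hasParity_tanh.substL n hn.add_one, add_zero]
  exact momentFunctional_coeff sechMoment invSqrtOneSubSq sechSeries n

theorem f_eq_coeff_of_odd {n : ℕ} (hn : Odd n) : (f n : ℚ) = coeff n (sumL tanhWeight) := by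
  have hone : HasParity (1 : ℚ[X]⟦X⟧) 0 := hasParity_one
  have h := f_eq_of_functional (n := n) (momentFunctional tanhMoment)
    (fun m => coeff m (1 * expL))
    (fun m => coeff m (1 * substL sechSeries + substL tanhSeries))
    (by rw [one_mul, coeff_zero_eq_constantCoeff_apply, constantCoeff_expL])
    (fun s hs => by
      simp only [one_mul]
      exact signedZigzagWords_eq_of_odd (hs ▸ Nat.not_even_iff_odd.2 hn))
    (sum_coeff_mul_quotient hone (one_mul 1))
  rw [h, map_add, (hone.mul hasParity_sech.substL) n (by simpa using hn), zero_add]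
  have := momentFunctional_coeff tanhMoment 1 tanhSeries n
  rwa [map_one, one_mul, one_mul] at this

/-- For even length `U` = √(1 - t²), so `U sech(yL)` is `1 - t²` times the series giving f; the
factor `t²` shifts the index by two. -/
theorem fStar_eq_sub (k : ℕ) :
    (fStar (2 * k + 2) : ℚ) = (f (2 * k + 2) : ℚ) - f (2 * k) := by
  have hn : Even (2 * k + 2) := by simp [Nat.even_add]
  have h := fStar_eq_of_functional k (momentFunctional sechMoment)
    (fun m => coeff m sqrtExpL)
    (fun m => coeff m (invSqrtPoly * substL sechSeries + substL tanhSeries))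
    (by rw [coeff_zero_eq_constantCoeff_apply, constantCoeff_sqrtExpL])
    (fun s hs => signedZigzagWords_eq_of_even (hs ▸ hn))
    (sum_coeff_mul_quotient hasParity_sqrtPoly sqrtPoly_mul_invSqrtPoly)
  rw [h, sqrtExpL, coeff_sub_sum_eq hasParity_sqrtPoly hasParity_invSqrtPoly]
  have e := momentFunctional_coeff sechMoment ((1 - X ^ 2) * invSqrtOneSubSq) sechSeries (2 * k + 2)
  rw [map_mul (PowerSeries.map _), map_one_sub_sq] at e
  refine e.trans ?_
  change coeff (2 * k + 2) ((1 - X ^ 2) * invSqrtOneSubSq * sumL sechWeight) = _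
  rw [f_eq_coeff_of_even hn, f_eq_coeff_of_even (even_two_mul k), mul_assoc, sub_mul, one_mul,
    map_sub, coeff_X_pow_mul]

lemma fOddSeries_eq : fOddSeries = sumL tanhWeight := by
  ext n
  rw [fOddSeries, coeff_mk]
  split_ifs with h
  · exact f_eq_coeff_of_odd h
  · refine (HasParity.sumL (k := 1) (fun r hr => tanhWeight_of_even ?_) n ?_).symm
    · rw [Nat.odd_iff] at hr; rw [Nat.even_iff]; omega
    · rw [Nat.odd_iff] at *; omega

lemma fEvenSeries_eq : fEvenSeries = invSqrtOneSubSq * sumL sechWeight := by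
  ext n
  rw [fEvenSeries, coeff_mk]
  split_ifs with h
  · exact f_eq_coeff_of_even h
  · exact ((hasParity_invSqrt.mul (HasParity.sumL (k := 0) fun r hr => sechWeight_of_odd
      (by simpa using hr))) n (by simpa using h)).symm

/-- The case k = 0 with f(-2) = 0: all alternation conditions are vacuous on the empty word. -/
lemma fStar_zero : fStar 0 = f 0 := by
  rw [fStar, f]
  refine Nat.card_congr (Equiv.subtypeEquivRight fun w => and_congr_right fun _ => ?_)
  constructor <;> intro _ i h <;> omega

end DoublyAlternating

theorem mainTheorem2 :
    -- `L(t) = t + t³/3 + t⁵/5 + ⋯`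
    (DoublyAlternating.L = PowerSeries.mk fun n : ℕ => if Odd n then (1 / n : ℚ) else 0) ∧
    -- `∑ₖ f(2k+1) t^(2k+1) = ∑ᵣ E_{2r+1}² L(t)^(2r+1) / (2r+1)!`
    DoublyAlternating.HasFormalSum
      (fun r : ℕ =>
        (((DoublyAlternating.eulerNumber (2 * r + 1) : ℚ) ^ 2 / (Nat.factorial (2 * r + 1) : ℚ)) •
          DoublyAlternating.L ^ (2 * r + 1)))
      DoublyAlternating.fOddSeries ∧
    -- `f*(2k+1) = f(2k+1)`
    (∀ k : ℕ, DoublyAlternating.fStar (2 * k + 1) = DoublyAlternating.f (2 * k + 1)) ∧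
    -- `∑ₖ f(2k) t^(2k) = (1 - t²)^(-1/2) ∑ᵣ E_{2r}² L(t)^(2r) / (2r)!`
    (∃ S : PowerSeries ℚ,
      DoublyAlternating.HasFormalSum
        (fun r : ℕ =>
          (((DoublyAlternating.eulerNumber (2 * r) : ℚ) ^ 2 / (Nat.factorial (2 * r) : ℚ)) •
            DoublyAlternating.L ^ (2 * r)))
        S ∧
      DoublyAlternating.fEvenSeries = DoublyAlternating.invSqrtOneSubSq * S) ∧
    -- `f*(2k) = f(2k) - f(2k-2)`, where `f(-2) = 0`
    DoublyAlternating.fStar 0 = DoublyAlternating.f 0 ∧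
    (∀ k : ℕ, 1 ≤ k →
      (DoublyAlternating.fStar (2 * k) : ℤ) =
        (DoublyAlternating.f (2 * k) : ℤ) - (DoublyAlternating.f (2 * k - 2) : ℤ)) := by
  refine ⟨DoublyAlternating.L_eq, ?_, fun k => ?_, ⟨_, DoublyAlternating.hasFormalSum_even,
    DoublyAlternating.fEvenSeries_eq⟩, DoublyAlternating.fStar_zero, fun k hk => ?_⟩
  · rw [DoublyAlternating.fOddSeries_eq]
    exact DoublyAlternating.hasFormalSum_odd
  · rw [DoublyAlternating.fStar_eq_reverseCount_of_odd (by simp),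
      DoublyAlternating.f_eq_reverseCount]
  · obtain ⟨k, rfl⟩ : ∃ j, k = j + 1 := ⟨k - 1, by omega⟩
    have h := DoublyAlternating.fStar_eq_sub k
    rw [show 2 * (k + 1) = 2 * k + 2 by ring, Nat.add_sub_cancel]
    exact_mod_cast h
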